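/- Let $F$ be an infinite field. For $n\ge 1$ let $\mathcal{A}_n(F)$ be the $\mathbb{Q}$-vector space spanned by symbols $((x_0,\dots,x_n))$, $x_i\in F$, modulo the relations: $((x_0,\dots,x_n))=((x_1,\dots,x_n,x_0))$; $((x_0+b,\dots,x_n+b))=((x_0,\dots,x_n))$ for $b\in F$; $((0,x))+((0,y))=((0,xy))$ for $x,y\in F^\times$; $((mx_0,\dots,mx_n))=((x_0,\dots,x_n))$ for $m\in F^\times$, $n\ge2$; $((0,\dots,0))=0$; $((1,0,\dots,0))=0$. Let $$\delta((x_0,\dots,x_n))=\sum_{j=0}^n\sum_{i=1}^{n-1}((x_j,\dots,x_{j+i}))\wedge((x_j,x_{j+i+1},\dots,x_{j+n}))$$ with indices modulo $n+1$. For $a\in F$ let $\mathrm{Sp}_{t\to a}\colon\mathcal{A}_n(F(t))\to\mathcal{A}_n(F)$ be the linear map that sends $((x_0,\dots,x_n))$, with the $x_i$ not all equal, to $((y_0(a),\dots,y_n(a)))$, where $x_i=(t-a)^s y_i+x_0$ and $s\in\mathbb{Z}$ is the largest integer for which all $y_i$ are regular at $t=a$ (and sends $((x,\dots,x))$ to $0$).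 Put $\mathcal{R}_1(F)=0$ and, recursively for $n\ge2$ and simultaneously for all infinite fields, let $\mathcal{R}_n(F)$ be the span of all $\mathrm{Sp}_{t\to0}(R)-\mathrm{Sp}_{t\to1}(R)$ with $R\in\mathcal{A}_n(F(t))$ such that $\delta(R)$ vanishes in the weight $n$ part of $\bigwedge^2\mathcal{L}^{\mathrm f}(F(t))$, where $\mathcal{L}^{\mathrm f}_m=\mathcal{A}_m/\mathcal{R}_m$. Write $\mathrm{cor}(x_0,\dots,x_n)\in\mathcal{L}^{\mathrm f}_n(F)$ for the class of $((x_0,\dots,x_n))$ and $\mathrm{I}^{\mathcal L}(x_0;x_1,\dots,x_n;x_{n+1})=\mathrm{cor}(x_1,\dots,x_{n+1})-\mathrm{cor}(x_0,\dots,x_n)$. For $k\ge1$, $n_0\ge0$, $n_1,\dots,n_k\ge1$, $n=n_0+n_1+\dots+n_k$ and $a_1,\dots,a_k\in F^\times$, put $$\mathrm{Li}^{\mathcal L}_{n_0;n_1,\dots,n_k}(a_1,\dots,a_k)=(-1)^k\,\mathrm{I}^{\mathcal L}(0;\underbrace{0,\dots,0,1}_{n_0+1},\underbrace{0,\dots,0,a_1}_{n_1},\dots,\underbrace{0,\dots,0,a_1\cdots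 a_{k-1}}_{n_{k-1}},\underbrace{0,\dots,0;a_1\cdots a_k}_{n_k})\in\mathcal{L}^{\mathrm f}_n(F),$$ and let $\mathcal{D}_d\mathcal{L}^{\mathrm f}_n(F)$ be the span of all such elements of weight $n$ with $1\le k\le d$ (so $\mathcal{D}_0\mathcal{L}^{\mathrm f}_n(F)=0$). **Lemma (Inversion).** Let $k\ge1$, $n_0\ge0$, $n_1,\dots,n_k\ge1$ with $n=n_0+n_1+\dots+n_k\ge2$, and let $x_1,\dots,x_k\in F^\times$. Then $$\mathrm{Li}^{\mathcal L}_{n_0;n_1,\dots,n_k}(x_1,\dots,x_k)-(-1)^{n+k}\,\mathrm{Li}^{\mathcal L}_{n_0;n_1,\dots,n_k}(x_1^{-1},\dots,x_k^{-1})\in\mathcal{D}_{k-1}\mathcal{L}^{\mathrm f}_n(F).$$ -/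

import Mathlib

open scoped TensorProduct

noncomputable section

namespace FormalPolylog

universe u

/-! ### The spaces `A n F` -/

/-- The free rational vector space on the symbols `((x_0, …, x_n))`, `x_i ∈ F`. -/
abbrev Symb (n : ℕ) (F : Type u) : Type u := (Fin (n + 1) → F) →₀ ℚ

/-- The defining relations of `𝒜_n(F)`: the listed elements become `0`. -/
inductive ARel (F : Type u) [Field F] : (n : ℕ) → Symb n F → Prop
  | cyclic {n : ℕ} (x : Fin (n + 1) → F) :
      ARel F n (Finsupp.single x 1 - Finsupp.single (fun i => x (i + 1)) 1)
  | translate {n : ℕ} (x : Fin (n + 1) → F) (b : F) :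
      ARel F n (Finsupp.single (fun i => x i + b) 1 - Finsupp.single x 1)
  | log (x y : Fˣ) :
      ARel F 1 (Finsupp.single ![0, (x : F)] 1 + Finsupp.single ![0, (y : F)] 1
        - Finsupp.single ![0, (x : F) * (y : F)] 1)
  | scale {n : ℕ} (hn : 2 ≤ n) (x : Fin (n + 1) → F) (m : Fˣ) :
      ARel F n (Finsupp.single (fun i => (m : F) * x i) 1 - Finsupp.single x 1)
  | zero {n : ℕ} : ARel F n (Finsupp.single (fun _ => 0) 1)
  | one {n : ℕ} : ARel F n (Finsupp.single (fun i => if i = 0 then 1 else 0) 1)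

/-- The rational vector space `𝒜_n(F)` (for `n = 0`, a weight that is never used, it is zero). -/
abbrev A (n : ℕ) (F : Type u) [Field F] : Type u :=
  Symb n F ⧸ Submodule.span ℚ {r : Symb n F | ARel F n r}

section
variable {F : Type u} [Field F]

/-- The class `((x_0, …, x_n))` in `𝒜_n(F)`. -/
def sym {n : ℕ} (x : Fin (n + 1) → F) : A n F :=
  (Submodule.span ℚ {r : Symb n F | ARel F n r}).mkQ (Finsupp.single x 1)

/-- A map on symbols that respects the relations extends linearly to `𝒜_n(F)`. -/
def liftA {n : ℕ} {M : Type*} [AddCommGroup M] [Module ℚ M] (f : (Fin (n + 1) → F) → M)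
    (h : ∀ r, ARel F n r → Finsupp.linearCombination ℚ f r = 0) : A n F →ₗ[ℚ] M :=
  Submodule.liftQ _ (Finsupp.linearCombination ℚ f)
    (Submodule.span_le.2 fun r hr => LinearMap.mem_ker.2 (h r hr))

@[simp] theorem liftA_sym {n : ℕ} {M : Type*} [AddCommGroup M] [Module ℚ M]
    (f : (Fin (n + 1) → F) → M) (h) (x : Fin (n + 1) → F) : liftA f h (sym x) = f x := by
  simp [liftA, sym]

theorem mkQ_eq_zero {n : ℕ} {r : Symb n F} (h : ARel F n r) :
    (Submodule.span ℚ {r : Symb n F | ARel F n r}).mkQ r = 0 :=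
  (Submodule.Quotient.mk_eq_zero _).2 (Submodule.subset_span h)

theorem sym_cyclic {n : ℕ} (x : Fin (n + 1) → F) : sym (fun i => x (i + 1)) = sym x :=
  (sub_eq_zero.1 (by simpa [sym] using mkQ_eq_zero (ARel.cyclic x))).symm

theorem sym_translate {n : ℕ} (x : Fin (n + 1) → F) (b : F) : sym (fun i => x i + b) = sym x :=
  sub_eq_zero.1 (by simpa [sym] using mkQ_eq_zero (ARel.translate x b))

theorem sym_log (x y : Fˣ) :
    sym ![0, (x : F) * (y : F)] = sym ![0, (x : F)] + sym ![0, (y : F)] :=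
  (sub_eq_zero.1 (by simpa [sym] using mkQ_eq_zero (ARel.log x y))).symm

theorem sym_scale {n : ℕ} (hn : 2 ≤ n) (x : Fin (n + 1) → F) (m : Fˣ) :
    sym (fun i => (m : F) * x i) = sym x :=
  sub_eq_zero.1 (by simpa [sym] using mkQ_eq_zero (ARel.scale hn x m))

theorem sym_const {n : ℕ} (b : F) : sym (fun _ : Fin (n + 1) => b) = 0 := by
  have h : sym (fun _ : Fin (n + 1) => (0 : F)) = 0 := mkQ_eq_zero ARel.zero
  rw [← h, ← sym_translate (fun _ : Fin (n + 1) => (0 : F)) b]; simp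

theorem sym_one {n : ℕ} : sym (fun i : Fin (n + 1) => if i = 0 then (1 : F) else 0) = 0 :=
  mkQ_eq_zero ARel.one

/-! ### The cobracket -/

/-- The periodic extension of `x_0, …, x_n`, with `x_{i+n+1} = x_i`. -/
def per {n : ℕ} (x : Fin (n + 1) → F) (i : ℕ) : F := x (Fin.ofNat (n + 1) i)

/-- `((f 0, f 1, …, f p))`. -/
def wd (p : ℕ) (f : ℕ → F) : A p F := sym fun i : Fin (p + 1) => f i

/-- `((x_j, x_{j+1}, …, x_{j+i}))`. -/
def cutL {n : ℕ} (x : Fin (n + 1) → F) (i j : ℕ) : A i F :=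
  wd i fun a => per x (j + a)

/-- `((x_j, x_{j+i+1}, …, x_{j+i+l}))`. -/
def cutR {n : ℕ} (x : Fin (n + 1) → F) (i l j : ℕ) : A l F :=
  wd l fun a => if a = 0 then per x j else per x (j + i + a)

/-- For `p + q = n`, the component in `𝒜_p ⊗ 𝒜_q` of
`∑_j ∑_i ((x_j, …, x_{j+i})) ∧ ((x_j, x_{j+i+1}, …, x_{j+n}))`, where `v ∧ w = v ⊗ w - w ⊗ v`:
the terms `v ⊗ w` with `i = p` and the terms `w ⊗ v` with `i = q`. -/
def cobracketFun {n : ℕ} (p q : ℕ) (x : Fin (n + 1) → F) : A p F ⊗[ℚ] A q F :=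
  ∑ j ∈ Finset.range (n + 1), (cutL x p j ⊗ₜ[ℚ] cutR x p q j - cutR x q p j ⊗ₜ[ℚ] cutL x q j)

theorem A_zero (v : A 0 F) : v = 0 := by
  obtain ⟨r, rfl⟩ := Submodule.mkQ_surjective _ v
  induction r using Finsupp.induction_linear with
  | zero => exact map_zero _
  | add f g hf hg => exact (map_add _ f g).trans (by rw [hf, hg, add_zero])
  | single x c =>
    have h : sym x = 0 := by
      rw [← sym_const (n := 0) (x 0)]; congr 1; funext i; rw [Fin.eq_zero i]
    have : (Finsupp.single x c : Symb 0 F) = c • Finsupp.single x 1 := by simp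
    rw [this, map_smul]
    exact (congrArg (c • ·) h).trans (smul_zero c)

theorem per_add {n : ℕ} (x : Fin (n + 1) → F) (i : ℕ) : per x (i + (n + 1)) = per x i := by
  simp [per, Fin.ofNat]

theorem wd_congr {p : ℕ} {f g : ℕ → F} (h : ∀ a ≤ p, f a = g a) : wd p f = wd p g := by
  unfold wd; congr 1; funext i; exact h i (by omega)

theorem wd_rot (p : ℕ) (f : ℕ → F) :
    wd p (fun a => if a = p then f 0 else f (a + 1)) = wd p f := by
  unfold wd
  rw [← sym_cyclic (fun i : Fin (p + 1) => f i)]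
  congr 1; funext i
  by_cases h : (i : ℕ) = p
  · have : i = Fin.last p := Fin.ext h
    subst this; simp
  · have : i < Fin.last p := lt_of_le_of_ne (Fin.le_last i) (fun e => h (by rw [e]; rfl))
    simp [h, Fin.val_add_one_of_lt this]

theorem wd_zero {p : ℕ} {f : ℕ → F} (b : F) (h : ∀ a ≤ p, f a = b) : wd p f = 0 := by
  rw [wd_congr (g := fun _ => b) h]; exact sym_const b

theorem wd_one {p : ℕ} {f : ℕ → F} (h0 : f 0 = 1) (h : ∀ a, 1 ≤ a → a ≤ p → f a = 0) :
    wd p f = 0 := by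
  rw [← sym_one (F := F) (n := p)]; unfold wd; congr 1; funext i
  by_cases hi : i = 0
  · simp [hi, h0]
  · rw [if_neg hi]; exact h i (Nat.one_le_iff_ne_zero.2 fun e => hi (Fin.ext e)) (by omega)

theorem wd_scale {p : ℕ} (hp : 2 ≤ p) (f : ℕ → F) (m : Fˣ) :
    wd p (fun a => (m : F) * f a) = wd p f := sym_scale hp _ m

theorem wd_pair (f : ℕ → F) : wd 1 f = sym ![0, f 1 - f 0] := by
  rw [← sym_translate ![0, f 1 - f 0] (f 0)]
  unfold wd; congr 1; funext i; fin_cases i <;> simp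

open Classical in
/-- `0` if `a = b`, and `1` otherwise. -/
def neq (a b : F) : ℚ := if a = b then 0 else 1

theorem wd_scale_one (f : ℕ → F) (m : Fˣ) :
    wd 1 (fun a => (m : F) * f a) =
      wd 1 f + neq (f 0) (f 1) • sym ![0, (m : F)] := by
  rw [wd_pair, wd_pair]
  by_cases h : f 0 = f 1
  · simp [h, neq]
  · rw [neq, if_neg h]
    have h' : f 1 - f 0 ≠ 0 := sub_ne_zero.2 (Ne.symm h)
    have := sym_log (Units.mk0 _ h') m
    simp only [Units.val_mk0] at this
    rw [← mul_sub, mul_comm, this, one_smul]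

theorem wd_pair_comm (f : ℕ → F) : wd 1 f = wd 1 (fun a => if a = 0 then f 1 else f 0) := by
  rw [← wd_rot 1 f]; exact wd_congr fun a ha => by
    rcases (show a = 0 ∨ a = 1 by omega) with rfl | rfl <;> simp

theorem sum_shift {M : Type*} [AddCommGroup M] {N : ℕ} {f : ℕ → M} (hf : f N = f 0) :
    ∑ j ∈ Finset.range N, f (j + 1) = ∑ j ∈ Finset.range N, f j := by
  have h1 := Finset.sum_range_succ f N
  have h2 := Finset.sum_range_succ' f N
  rw [h1, hf] at h2
  exact (add_right_cancel h2).symm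

theorem cobracketFun_comm {n : ℕ} (p q : ℕ) (x : Fin (n + 1) → F) :
    cobracketFun p q x = - TensorProduct.comm ℚ _ _ (cobracketFun q p x) := by
  simp [cobracketFun, map_sum]

theorem cutL_per {n : ℕ} (x : Fin (n + 1) → F) (i j : ℕ) :
    cutL x i (j + (n + 1)) = cutL x i j :=
  wd_congr fun a _ => by rw [← per_add x (j + a)]; congr 1; omega

theorem cutR_one {q : ℕ} (x : Fin (q + 1 + 1) → F) (j : ℕ) :
    cutR x 1 q j = cutL x q (j + 2) := by
  unfold cutR cutL
  rw [← wd_rot q (fun a => if a = 0 then per x j else per x (j + 1 + a))]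
  refine wd_congr fun a ha => ?_
  by_cases h : a = q
  · simp only [h, if_true]; rw [← per_add x j]; congr 1; omega
  · simp only [h, if_false, Nat.add_eq_zero_iff, one_ne_zero, and_false]; congr 1; omega

theorem telescope_aux {q : ℕ} (x : Fin (q + 1 + 1) → F) :
    ∑ j ∈ Finset.range (q + 1 + 1),
      (neq (per x j) (per x (j + 1)) • cutL x q (j + 2)
        - neq (per x j) (per x (j + q + 1)) • cutL x q j) = 0 := by
  rw [Finset.sum_sub_distrib, ← sum_shift (f := fun j =>
    neq (per x j) (per x (j + q + 1)) • cutL x q j), ← Finset.sum_sub_distrib]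
  · have key : ∀ j, neq (per x j) (per x (j + 1)) • cutL x q (j + 2)
        - neq (per x (j + 1)) (per x (j + 1 + q + 1)) • cutL x q (j + 1)
        = cutL x q (j + 1 + 1) - cutL x q (j + 1) := by
      intro j
      have e : per x (j + 1 + q + 1) = per x j := by
        rw [← per_add x j]; congr 1; omega
      rw [e]
      by_cases h : per x j = per x (j + 1)
      · have : cutL x q (j + 1 + 1) = cutL x q (j + 1) := by
          unfold cutL
          rw [← wd_rot q (fun a => per x (j + 1 + a))]
          refine wd_congr fun a ha => ?_
          split_ifs with h'
          · rw [add_zero, ← h, ← per_add x j]; congr 1; omega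
          · congr 1; omega
        rw [this, neq, neq, if_pos h, if_pos h.symm]; simp
      · rw [neq, neq, if_neg h, if_neg (fun e => h e.symm)]; simp
    rw [Finset.sum_congr rfl fun j _ => key j,
      Finset.sum_range_sub (fun j => cutL x q (j + 1)), sub_eq_zero]
    have := cutL_per x q 1
    rw [← this]; congr 1; omega
  · have h1 := cutL_per x q 0
    have h2 := per_add x 0
    have h3 := per_add x (0 + q + 1)
    simp only [zero_add] at h1 h2 h3
    have h4 : per x (q + 1 + 1 + q + 1) = per x (q + 1) := by
      rw [← h3]; congr 1; omega
    simp only [zero_add, h1, h2, h4]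

theorem per_mul {n : ℕ} (x : Fin (n + 1) → F) (m : F) (i : ℕ) :
    per (fun i => m * x i) i = m * per x i := rfl

theorem cutL_scale {n : ℕ} {p : ℕ} (hp : 2 ≤ p) (x : Fin (n + 1) → F) (m : Fˣ) (j : ℕ) :
    cutL (fun i => (m : F) * x i) p j = cutL x p j := wd_scale hp _ m

theorem cutR_scale {n : ℕ} {l : ℕ} (hp : 2 ≤ l) (x : Fin (n + 1) → F) (m : Fˣ) (i j : ℕ) :
    cutR (fun i => (m : F) * x i) i l j = cutR x i l j := by
  unfold cutR
  rw [← wd_scale hp (fun a => if a = 0 then per x j else per x (j + i + a)) m]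
  exact wd_congr fun a _ => by split_ifs <;> rfl

theorem cutL_scale_one {n : ℕ} (x : Fin (n + 1) → F) (m : Fˣ) (j : ℕ) :
    cutL (fun i => (m : F) * x i) 1 j = cutL x 1 j +
      neq (per x j) (per x (j + 1)) • sym ![0, (m : F)] :=
  wd_scale_one _ m

theorem cutR_scale_one {n : ℕ} (x : Fin (n + 1) → F) (m : Fˣ) (i j : ℕ) :
    cutR (fun i => (m : F) * x i) i 1 j = cutR x i 1 j +
      neq (per x j) (per x (j + i + 1)) • sym ![0, (m : F)] := by
  have := wd_scale_one (fun a => if a = 0 then per x j else per x (j + i + a)) m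
  simp only [if_pos, one_ne_zero, if_false] at this
  unfold cutR
  rw [← this]; exact wd_congr fun a _ => by split_ifs <;> rfl

theorem cobracketFun_scale_one {q : ℕ} (hq : 1 ≤ q) (x : Fin (q + 1 + 1) → F) (m : Fˣ) :
    cobracketFun 1 q (fun i => (m : F) * x i) = cobracketFun 1 q x := by
  have K := telescope_aux x
  rw [← sub_eq_zero]
  unfold cobracketFun
  rw [← Finset.sum_sub_distrib]
  rcases hq.eq_or_lt with rfl | hq
  · have K1 := congrArg (fun v => sym ![0, (m : F)] ⊗ₜ[ℚ] v) K
    have K2 := congrArg (fun v => v ⊗ₜ[ℚ] sym ![0, (m : F)]) K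
    simp only [TensorProduct.tmul_sum, TensorProduct.sum_tmul, TensorProduct.tmul_zero,
      TensorProduct.zero_tmul] at K1 K2
    have K3 := congrArg₂ (· - ·) K1 K2
    simp only [sub_zero, ← Finset.sum_sub_distrib] at K3
    rw [← K3]
    refine Finset.sum_congr rfl fun j _ => ?_
    rw [cutL_scale_one, cutR_scale_one, ← cutR_one]
    simp only [TensorProduct.tmul_add, TensorProduct.add_tmul, TensorProduct.tmul_sub,
      TensorProduct.sub_tmul, TensorProduct.tmul_smul, ← TensorProduct.smul_tmul']
    module
  · have K1 := congrArg (fun v => sym ![0, (m : F)] ⊗ₜ[ℚ] v) K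
    simp only [TensorProduct.tmul_sum, TensorProduct.tmul_zero] at K1
    rw [← K1]
    refine Finset.sum_congr rfl fun j _ => ?_
    rw [cutL_scale_one, cutR_scale_one, cutR_scale hq, cutL_scale hq, ← cutR_one]
    simp only [TensorProduct.add_tmul, TensorProduct.tmul_sub,
      TensorProduct.tmul_smul, TensorProduct.smul_tmul']
    abel

theorem cobracketFun_scale {n p q : ℕ} (h : p + q = n) (x : Fin (n + 1) → F)
    (m : Fˣ) : cobracketFun p q (fun i => (m : F) * x i) = cobracketFun p q x := by
  have aux0 : ∀ (q : ℕ) (t : A 0 F ⊗[ℚ] A q F), t = 0 := fun q t => by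
    induction t with
    | zero => rfl
    | tmul a b => rw [A_zero a, TensorProduct.zero_tmul]
    | add a b ha hb => rw [ha, hb, add_zero]
  have aux0' : ∀ (p : ℕ) (t : A p F ⊗[ℚ] A 0 F), t = 0 := fun q t => by
    induction t with
    | zero => rfl
    | tmul a b => rw [A_zero b, TensorProduct.tmul_zero]
    | add a b ha hb => rw [ha, hb, add_zero]
  rcases Nat.eq_zero_or_pos p with rfl | hp
  · rw [aux0 _ (cobracketFun _ _ _), aux0 _ (cobracketFun _ _ x)]
  rcases Nat.eq_zero_or_pos q with rfl | hq
  · rw [aux0' _ (cobracketFun _ _ _), aux0' _ (cobracketFun _ _ x)]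
  rcases (Nat.succ_le_of_lt hp).eq_or_lt with rfl | hp'
  · obtain rfl : n = q + 1 := by omega
    exact cobracketFun_scale_one hq x m
  rcases (Nat.succ_le_of_lt hq).eq_or_lt with rfl | hq'
  · obtain rfl : n = p + 1 := by omega
    rw [cobracketFun_comm, cobracketFun_scale_one hp x m, ← cobracketFun_comm]
  · unfold cobracketFun
    simp only [cutL_scale hp', cutL_scale hq', cutR_scale hp', cutR_scale hq']

theorem cobracketFun_rel {n p q : ℕ} (h : p + q = n) (r : Symb n F) (hr : ARel F n r) :
    Finsupp.linearCombination ℚ (cobracketFun p q) r = 0 := by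
  cases hr with
  | cyclic x =>
    have hper : ∀ i, per (fun i => x (i + 1)) i = per x (i + 1) := fun i => by
      unfold per; exact congrArg x (Fin.ext (by simp [Fin.val_add, Fin.ofNat]))
    have hL : ∀ p j, cutL (fun i => x (i + 1)) p j = cutL x p (j + 1) := fun p j =>
      wd_congr fun a _ => by rw [hper]; congr 1; omega
    have hR : ∀ p q j, cutR (fun i => x (i + 1)) p q j = cutR x p q (j + 1) := fun p q j =>
      wd_congr fun a _ => by
        rw [hper, hper]; split_ifs
        · rfl
        · congr 1; omega
    have hR' : ∀ p q, cutR x p q (n + 1) = cutR x p q 0 := fun p q =>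
      wd_congr fun a _ => by
        split_ifs
        · simpa using per_add x 0
        · rw [← per_add x (0 + p + a)]; congr 1; omega
    have hL' : ∀ p, cutL x p (n + 1) = cutL x p 0 := fun p => by
      simpa using cutL_per x p 0
    simp only [map_sub, Finsupp.linearCombination_single, one_smul]
    rw [sub_eq_zero]
    unfold cobracketFun
    simp only [hL, hR]
    rw [sum_shift (f := fun j => cutL x p j ⊗ₜ[ℚ] cutR x p q j - cutR x q p j ⊗ₜ[ℚ] cutL x q j)]
    simp only [hL', hR']
  | translate x b =>
    have hL : ∀ p j, cutL (fun i => x i + b) p j = cutL x p j := fun p j => sym_translate _ b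
    have hR : ∀ p q j, cutR (fun i => x i + b) p q j = cutR x p q j := fun p q j => by
      unfold cutR wd
      rw [← sym_translate (fun i : Fin (q + 1) =>
        (fun a => if a = 0 then per x j else per x (j + p + a)) (i : ℕ)) b]
      congr 1; funext i; dsimp only; split_ifs <;> rfl
    simp only [map_sub, Finsupp.linearCombination_single, one_smul, cobracketFun, hL, hR, sub_self]
  | log x y =>
    have : ∀ t : A p F ⊗[ℚ] A q F, t = 0 := fun t => by
      induction t with
      | zero => rfl
      | tmul a b =>
        rcases (show p = 0 ∨ q = 0 by omega) with rfl | rfl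
        · rw [A_zero a, TensorProduct.zero_tmul]
        · rw [A_zero b, TensorProduct.tmul_zero]
      | add a b ha hb => rw [ha, hb, add_zero]
    exact this _
  | scale hn x m =>
    simp only [map_sub, Finsupp.linearCombination_single, one_smul, cobracketFun_scale h, sub_self]
  | zero =>
    have hL : ∀ p j, cutL (fun _ : Fin (n + 1) => (0 : F)) p j = 0 := fun p j =>
      wd_zero 0 fun _ _ => rfl
    simp [cobracketFun, hL]
  | one =>
    have hper : ∀ i, i < 2 * (n + 1) → i ≠ 0 → i ≠ n + 1 →
        per (fun i : Fin (n + 1) => if i = 0 then (1 : F) else 0) i = 0 := by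
      intro i h1 h2 h3
      refine if_neg fun e => ?_
      have := congrArg Fin.val e
      simp only [Fin.ofNat, Fin.val_zero] at this
      obtain ⟨c, hc⟩ := Nat.dvd_of_mod_eq_zero this
      rcases c with _ | _ | c
      · omega
      · omega
      · rw [hc] at h1
        have : (n + 1) * (c + 1 + 1) = (n + 1) * c + 2 * (n + 1) := by ring
        omega
    have hper0 : per (fun i : Fin (n + 1) => if i = 0 then (1 : F) else 0) 0 = 1 := by
      simp [per]
    simp only [Finsupp.linearCombination_single, one_smul]
    have main : ∀ p q j, p + q = n → j < n + 1 →
        cutL (fun i : Fin (n + 1) => if i = 0 then (1 : F) else 0) p j = 0 ∨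
        cutR (fun i : Fin (n + 1) => if i = 0 then (1 : F) else 0) p q j = 0 := by
      intro p q j h hj
      rcases Nat.eq_zero_or_pos j with rfl | hj0
      · left
        refine wd_one (by simpa using hper0) fun a h1 h2 => hper _ ?_ ?_ ?_ <;> omega
      · by_cases hc : j + p < n + 1
        · left
          refine wd_zero 0 fun a h1 => hper _ ?_ ?_ ?_ <;> omega
        · right
          refine wd_zero 0 fun a h1 => ?_
          split_ifs with ha
          · refine hper _ ?_ ?_ ?_ <;> omega
          · refine hper _ ?_ ?_ ?_ <;> omega
    refine Finset.sum_eq_zero fun j hj => ?_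
    have hj := Finset.mem_range.1 hj
    have e1 : cutL (fun i : Fin (n + 1) => if i = 0 then (1 : F) else 0) p j ⊗ₜ[ℚ]
        cutR (fun i : Fin (n + 1) => if i = 0 then (1 : F) else 0) p q j = 0 := by
      rcases main p q j h hj with e | e <;> simp [e]
    have e2 : cutR (fun i : Fin (n + 1) => if i = 0 then (1 : F) else 0) q p j ⊗ₜ[ℚ]
        cutL (fun i : Fin (n + 1) => if i = 0 then (1 : F) else 0) q j = 0 := by
      rcases main q p j (by omega) hj with e | e <;> simp [e]
    rw [e1, e2, sub_zero]

/-- The component `𝒜_n(F) → 𝒜_p(F) ⊗ 𝒜_q(F)`, `p + q = n`, of the Lie cobracket `δ`. -/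
def cobracket {n p q : ℕ} (h : p + q = n) : A n F →ₗ[ℚ] A p F ⊗[ℚ] A q F :=
  liftA (cobracketFun p q) (cobracketFun_rel h)

/-! ### Specialization -/

open scoped RatFunc in
/-- The expansion `F(t) → F((s))`, `s = t - a`, of rational functions at `t = a`. -/
def expandAt (a : F) : RatFunc F →+* LaurentSeries F :=
  (algebraMap (RatFunc F) (LaurentSeries F)).comp (RatFunc.laurent a).toRingHom

/-- `x_0, …, x_n ∈ F(t)` are congruent modulo `(t - a)^s`: every difference `x_i - x_j` vanishes at
`t = a` to order at least `s`. -/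
def Congruent {n : ℕ} (a : F) (s : ℤ) (x : Fin (n + 1) → RatFunc F) : Prop :=
  ∀ i j, ∀ r < s, (expandAt a (x i - x j)).coeff r = 0

/-- The largest `s` such that the `x_i` are congruent modulo `(t - a)^s`
(if the `x_i` are all equal there is no largest one and the value is irrelevant). -/
def spExp {n : ℕ} (a : F) (x : Fin (n + 1) → RatFunc F) : ℤ := sSup {s : ℤ | Congruent a s x}

/-- Write `x_i = y_i (t - a)^s + x_0` with `s` as large as possible; then this is the tuple of the
values of the `y_i` at `t = a`, that is, of the coefficients of `(t - a)^s` in `x_i - x_0`.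
If all `x_i` are equal, it is `(0, …, 0)`. -/
def spTuple {n : ℕ} (a : F) (x : Fin (n + 1) → RatFunc F) (i : Fin (n + 1)) : F :=
  (expandAt a (x i - x 0)).coeff (spExp a x)

theorem coeff_mul_of_low {f g : LaurentSeries F} (hf : f ≠ 0) {s : ℤ}
    (hg : ∀ r < s, g.coeff r = 0) :
    (∀ r < f.order + s, (f * g).coeff r = 0) ∧
      (f * g).coeff (f.order + s) = f.leadingCoeff * g.coeff s := by
  by_cases h0 : g = 0
  · simp [h0]
  have hs : s ≤ g.order := by
    by_contra h
    exact h0 (HahnSeries.coeff_order_eq_zero.1 (hg _ (not_le.1 h)))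
  have ho : (f * g).order = f.order + g.order := HahnSeries.order_mul hf h0
  refine ⟨fun r hr => HahnSeries.coeff_eq_zero_of_lt_order (by omega), ?_⟩
  rcases hs.eq_or_lt with rfl | hs
  · rw [HahnSeries.coeff_mul_order_add_order, HahnSeries.leadingCoeff_eq (x := g)]
  · rw [HahnSeries.coeff_eq_zero_of_lt_order (by omega),
      HahnSeries.coeff_eq_zero_of_lt_order hs, mul_zero]

theorem expandAt_ne_zero {a : F} {x : RatFunc F} (hx : x ≠ 0) : expandAt a x ≠ 0 :=
  (map_ne_zero _).2 hx

theorem spExp_eq {n : ℕ} {a : F} {x : Fin (n + 1) → RatFunc F} {s : ℤ} (h : Congruent a s x)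
    {i j : Fin (n + 1)} (hij : (expandAt a (x i - x j)).coeff s ≠ 0) : spExp a x = s :=
  IsGreatest.csSup_eq ⟨h, fun _ hr => not_lt.1 fun hlt => hij (hr i j s hlt)⟩

theorem exists_spExp {n : ℕ} (a : F) {x : Fin (n + 1) → RatFunc F} (hx : ∃ i, x i ≠ x 0) :
    Congruent a (spExp a x) x ∧ ∃ i j, (expandAt a (x i - x j)).coeff (spExp a x) ≠ 0 := by
  classical
  let S : Finset (Fin (n + 1) × Fin (n + 1)) := Finset.univ.filter fun p => x p.1 ≠ x p.2
  obtain ⟨i₀, hi₀⟩ := hx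
  have hS : S.Nonempty := ⟨(i₀, 0), by simp [S, hi₀]⟩
  obtain ⟨⟨i, j⟩, hij, hmin⟩ :=
    S.exists_min_image (fun p => (expandAt a (x p.1 - x p.2)).order) hS
  have hc : Congruent a (expandAt a (x i - x j)).order x := by
    intro k l r hr
    by_cases hkl : x k = x l
    · simp [hkl]
    · exact HahnSeries.coeff_eq_zero_of_lt_order
        (hr.trans_le (hmin (k, l) (by simp [S, hkl])))
  have hne : (expandAt a (x i - x j)).coeff (expandAt a (x i - x j)).order ≠ 0 := by
    rw [Ne, HahnSeries.coeff_order_eq_zero]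
    exact expandAt_ne_zero (sub_ne_zero.2 (by simpa [S] using hij))
  rw [spExp_eq hc hne]
  exact ⟨hc, i, j, hne⟩

theorem spTuple_const {n : ℕ} {a : F} {x : Fin (n + 1) → RatFunc F} (h : ∀ i, x i = x 0) :
    spTuple a x = fun _ => 0 := by
  funext i; simp [spTuple, h i]

theorem spTuple_scale {n : ℕ} (a : F) (x : Fin (n + 1) → RatFunc F) (m : (RatFunc F)ˣ) :
    spTuple a (fun i => (m : RatFunc F) * x i) =
      fun i => (expandAt a (m : RatFunc F)).leadingCoeff * spTuple a x i := by
  by_cases h : ∃ i, x i ≠ x 0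
  · obtain ⟨hc, k, l, hkl⟩ := exists_spExp a h
    have hm : expandAt a (m : RatFunc F) ≠ 0 := expandAt_ne_zero m.ne_zero
    have hlow := fun i j => coeff_mul_of_low hm (hc i j)
    have hs : spExp a (fun i => (m : RatFunc F) * x i) =
        (expandAt a (m : RatFunc F)).order + spExp a x := by
      refine spExp_eq (i := k) (j := l) (fun i j r hr => ?_) ?_
      · rw [← mul_sub, map_mul]; exact (hlow i j).1 r hr
      · rw [← mul_sub, map_mul, (hlow k l).2]
        exact mul_ne_zero (HahnSeries.leadingCoeff_ne_zero.2 hm) hkl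
    funext i
    unfold spTuple
    rw [hs, ← mul_sub, map_mul, (hlow i 0).2]
  · push Not at h
    rw [spTuple_const h, spTuple_const (fun i => by rw [h i])]
    simp

theorem spTuple_pair (a : F) (x : (RatFunc F)ˣ) :
    spTuple a ![0, (x : RatFunc F)] = ![0, (expandAt a (x : RatFunc F)).leadingCoeff] := by
  have hx : expandAt a (x : RatFunc F) ≠ 0 := expandAt_ne_zero x.ne_zero
  have hs : spExp a ![0, (x : RatFunc F)] = (expandAt a (x : RatFunc F)).order := by
    refine spExp_eq (i := 1) (j := 0) (fun i j r hr => ?_) ?_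
    · have := HahnSeries.coeff_eq_zero_of_lt_order hr
      fin_cases i <;> fin_cases j <;> simp [this]
    · simp [HahnSeries.coeff_order_eq_zero]
  funext i
  fin_cases i <;> simp [spTuple, hs, HahnSeries.leadingCoeff_eq]

theorem spTuple_rel {n : ℕ} (a : F) (r : Symb n (RatFunc F)) (hr : ARel (RatFunc F) n r) :
    Finsupp.linearCombination ℚ (fun x => sym (spTuple a x)) r = 0 := by
  cases hr with
  | cyclic x =>
    simp only [map_sub, Finsupp.linearCombination_single, one_smul]
    have hs : spExp a (fun i => x (i + 1)) = spExp a x := by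
      unfold spExp; congr 1; ext s
      refine ⟨fun h i j => ?_, fun h i j => h _ _⟩
      simpa using h (i - 1) (j - 1)
    have : spTuple a (fun i => x (i + 1)) = fun i => spTuple a x (i + 1) + - spTuple a x 1 := by
      funext i
      simp only [spTuple, hs, zero_add, ← sub_eq_add_neg]
      rw [← HahnSeries.coeff_sub, ← map_sub]; congr 2; ring
    rw [this, sym_translate (fun i => spTuple a x (i + 1)), sym_cyclic, sub_self]
  | translate x b =>
    simp only [map_sub, Finsupp.linearCombination_single, one_smul]
    have : spTuple a (fun i => x i + b) = spTuple a x := by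
      funext i; simp [spTuple, spExp, Congruent]
    rw [this, sub_self]
  | log x y =>
    simp only [map_sub, map_add, Finsupp.linearCombination_single, one_smul]
    have hx := HahnSeries.leadingCoeff_ne_zero.2 (expandAt_ne_zero (a := a) x.ne_zero)
    have hy := HahnSeries.leadingCoeff_ne_zero.2 (expandAt_ne_zero (a := a) y.ne_zero)
    have h1 := sym_log (Units.mk0 _ hx) (Units.mk0 _ hy)
    have h2 := spTuple_pair a (x * y)
    simp only [Units.val_mk0] at h1
    rw [Units.val_mul, map_mul, HahnSeries.leadingCoeff_mul] at h2
    rw [h2, spTuple_pair, spTuple_pair, h1, sub_self]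
  | scale hn x m =>
    simp only [map_sub, Finsupp.linearCombination_single, one_smul]
    have hm := HahnSeries.leadingCoeff_ne_zero.2 (expandAt_ne_zero (a := a) m.ne_zero)
    have := sym_scale hn (spTuple a x) (Units.mk0 _ hm)
    simp only [Units.val_mk0] at this
    rw [spTuple_scale, this, sub_self]
  | zero =>
    simp only [Finsupp.linearCombination_single, one_smul]
    rw [spTuple_const (fun _ => rfl), sym_const]
  | one =>
    simp only [Finsupp.linearCombination_single, one_smul]
    by_cases hn : n = 0
    · subst hn; exact A_zero _
    have h1 : (Fin.last n) ≠ 0 := fun e => hn (congrArg Fin.val e)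
    have hs : spExp a (fun i : Fin (n + 1) => if i = 0 then (1 : RatFunc F) else 0) = 0 := by
      refine spExp_eq (i := 0) (j := Fin.last n) (fun i j r hr => ?_) ?_
      · split_ifs <;> simp [hr.ne]
      · simp [h1]
    have : spTuple a (fun i : Fin (n + 1) => if i = 0 then (1 : RatFunc F) else 0) =
        fun i => (if i = 0 then (1 : F) else 0) + -1 := by
      funext i
      simp only [spTuple, hs]
      split_ifs <;> simp_all
    rw [this, sym_translate (fun i : Fin (n + 1) => if i = 0 then (1 : F) else 0), sym_one]

/-- The specialization homomorphism `Sp_{t → a} : 𝒜_n(F(t)) → 𝒜_n(F)`. -/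
def Sp (n : ℕ) (a : F) : A n (RatFunc F) →ₗ[ℚ] A n F :=
  liftA (fun x => sym (spTuple a x)) (spTuple_rel a)

end

/-! ### The spaces of relations and the quotients `L n F` -/

/-- The space of relations `ℛ_n(F) ⊆ 𝒜_n(F)`, by recursion on the weight `n`, simultaneously for all
fields `F`. It vanishes for `n = 1`; for `n ≥ 2` it is spanned by `Sp_{t→0} r - Sp_{t→1} r` for the
`r ∈ 𝒜_n(F(t))` whose cobracket vanishes in weight `n` of `⋀² ℒ(F(t))`, that is, in
`ℒ_p(F(t)) ⊗ ℒ_q(F(t))` for all `p, q ≥ 1` with `p + q = n`, where `ℒ_p = 𝒜_p / ℛ_p`. -/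
def relSpace (n : ℕ) (F : Type u) [Field F] : Submodule ℚ (A n F) :=
  if 2 ≤ n then
    Submodule.span ℚ {v | ∃ r : A n (RatFunc F),
      (∀ (p q : ℕ) (h : p + q = n) (_ : 1 ≤ p) (_ : 1 ≤ q),
        TensorProduct.map (relSpace p (RatFunc F)).mkQ (relSpace q (RatFunc F)).mkQ (cobracket h r) = 0) ∧
      v = Sp n 0 r - Sp n 1 r}
  else ⊥
termination_by n
decreasing_by all_goals omega

/-- The weight `n` part `ℒ_n(F)` of the Lie coalgebra of formal multiple polylogarithms. -/
abbrev L (n : ℕ) (F : Type u) [Field F] : Type u := A n F ⧸ relSpace n F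

section
variable {F : Type u} [Field F]

/-- The correlator `cor(x_0, …, x_n) ∈ ℒ_n(F)`. -/
def cor {n : ℕ} (x : Fin (n + 1) → F) : L n F := (relSpace n F).mkQ (sym x)

/-- The iterated integral
`I(x_0; x_1, …, x_n; x_{n+1}) = cor(x_1, …, x_{n+1}) - cor(x_0, …, x_n)` in `ℒ_n(F)`. -/
def iterInt {n : ℕ} (x : Fin (n + 2) → F) : L n F :=
  cor (fun i : Fin (n + 1) => x i.succ) - cor (fun i : Fin (n + 1) => x i.castSucc)

/-- The sequence `0; 0,…,0,1, 0,…,0,a_1, …, 0,…,0,a_1⋯a_{k-1}, 0,…,0; a_1⋯a_k` whose blocks after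
the initial `0` have lengths `n₀ + 1, n_1, …, n_k`. -/
def liWord {k : ℕ} (n₀ : ℕ) (w : Fin k → ℕ+) (a : Fin k → Fˣ) : List F :=
  0 :: (List.replicate n₀ 0 ++ [1] ++
    (List.ofFn fun i : Fin k =>
      List.replicate ((w i : ℕ) - 1) 0 ++ [∏ j ∈ Finset.Iic i, (a j : F)]).flatten)

theorem liWord_length {k n : ℕ} (n₀ : ℕ) (w : Fin k → ℕ+) (a : Fin k → Fˣ)
    (h : n₀ + ∑ i, (w i : ℕ) = n) : (liWord n₀ w a).length = n + 2 := by
  have h1 : ∀ i, (w i : ℕ) - 1 + 1 = w i := fun i => Nat.sub_add_cancel (w i).pos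
  simp [liWord, List.length_flatten, List.map_ofFn, Function.comp_def, List.sum_ofFn, h1, ← h]
  omega

/-- The projection to `ℒ_n(F)` of the multiple polylogarithm `Li_{n₀; n_1, …, n_k}(a_1, …, a_k)`
of weight `n = n₀ + n_1 + … + n_k`. -/
def Li {k n : ℕ} (n₀ : ℕ) (w : Fin k → ℕ+) (a : Fin k → Fˣ) (h : n₀ + ∑ i, (w i : ℕ) = n) :
    L n F :=
  (-1 : ℚ) ^ k • iterInt fun i : Fin (n + 2) =>
    (liWord n₀ w a)[(i : ℕ)]'(by rw [liWord_length n₀ w a h]; exact i.isLt)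

end

/-- The depth filtration: `𝒟_k ℒ_n(F)` is spanned by the (projections of the) multiple
polylogarithms of weight `n` and of depth at most `k`; the depth of a polylogarithm is positive. -/
def depthFiltration (k n : ℕ) (F : Type u) [Field F] : Submodule ℚ (L n F) :=
  Submodule.span ℚ {v | ∃ (l n₀ : ℕ) (w : Fin l → ℕ+) (a : Fin l → Fˣ)
    (h : n₀ + ∑ i, (w i : ℕ) = n), 1 ≤ l ∧ l ≤ k ∧ v = Li n₀ w a h}

end FormalPolylog

end

/-! Correlators satisfy an exact inversion formula. The substitution t ↦ 1/t turns dlog(t - x) into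
dlog(t - 1/x) - dlog t for x ≠ 0, and into -dlog t for x = 0. This suggests replacing each letter x
of a word X by [x⁻¹] - [0] (by -[0] if x = 0) and expanding multilinearly. For z ≠ 0 and weight at
least 2, the expansion of cor(z⁻¹, X) is cor(z, X) - cor(0, X). This is `InvFormula`; its companion
`InvFormulaInfty` says that the expansion of cor(0, X) is -cor(0, X).

Both formulas are proved by induction on the weight, over all fields at once (`invFormula`). Weight
1 is a computation with logarithms. In higher weight let z be a nonconstant element of F(t) and X a
word of constants. The formulas of lower weight over F(t) show that the defect of the formula has
zero cobracket (`cobracket_invDefect`), so its specializations at t = 0 and t = 1 agree modulo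
ℛ_n(F). For z = ct the specialization at 0 is trivial and the one at 1 is the defect for c
(`invDefect_mem`); z = 1/t then gives the companion formula.

For polylogarithms, write the defining word as 0 Y z, so that Li is ±(cor(z, Y) - cor(0, Y)), where
Y has n letters, k of them nonzero. In the expansion of cor(z⁻¹, Y) a single term has k + 1 nonzero
letters: every nonzero letter is inverted and the n - k zeros give the sign (-1)^(n+k)
(`wordInv_sub_leading_mem`). All other correlators have at most k nonzero letters, hence depth at
most k - 1 (`wordCor_mem_depthFiltration`). -/

noncomputable section

namespace FormalPolylog

universe u

section
variable {F : Type u} [Field F]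

/-- The class in `𝒜_n(F)` of a word of length `n + 1`. -/
def wordSym (n : ℕ) (l : List F) : A n F := wd n fun i => l.getD i 0

/-- The correlator in `ℒ_n(F)` of a word of length `n + 1`. -/
def wordCor (n : ℕ) (l : List F) : L n F := (relSpace n F).mkQ (wordSym n l)

open Classical in
/-- Substitution of `[x⁻¹] - [0]` (of `-[0]` if `x = 0`) into the linear extension of `g`. -/
def letterInv {M : Type*} [AddCommGroup M] (x : F) (g : F → M) : M :=
  (if x = 0 then 0 else g x⁻¹) - g 0

/-- Substitution of `[x⁻¹] - [0]` for every letter `x` of a word into the multilinear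
extension of `g`. -/
def wordInv {M : Type*} [AddCommGroup M] : List F → (List F → M) → M
  | [], g => g []
  | x :: l, g => letterInv x fun u => wordInv l fun l' => g (u :: l')

section wordInv
variable {M N : Type*} [AddCommGroup M] [AddCommGroup N]

theorem map_letterInv (f : M →+ N) (x : F) (g : F → M) :
    f (letterInv x g) = letterInv x fun u => f (g u) := by
  unfold letterInv; split_ifs <;> simp

theorem letterInv_add (x : F) (g h : F → M) :
    letterInv x (fun u => g u + h u) = letterInv x g + letterInv x h := by
  unfold letterInv; split_ifs <;> (dsimp only; abel)

theorem map_wordInv (f : M →+ N) (l : List F) (g : List F → M) :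
    f (wordInv l g) = wordInv l fun l' => f (g l') := by
  induction l generalizing g with
  | nil => rfl
  | cons x l ih => simp only [wordInv, map_letterInv, ih]

theorem wordInv_congr {l : List F} {g h : List F → M}
    (H : ∀ l', l'.length = l.length → g l' = h l') : wordInv l g = wordInv l h := by
  induction l generalizing g h with
  | nil => exact H [] rfl
  | cons x l ih =>
    have : ∀ u, wordInv l (fun l' => g (u :: l')) = wordInv l fun l' => h (u :: l') :=
      fun u => ih fun l' hl' => H _ (by simp [hl'])
    simp only [wordInv, this]

theorem wordInv_add (l : List F) (g h : List F → M) :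
    wordInv l (fun l' => g l' + h l') = wordInv l g + wordInv l h := by
  induction l generalizing g h with
  | nil => rfl
  | cons x l ih => simp only [wordInv, ih, letterInv_add]

theorem wordInv_neg (l : List F) (g : List F → M) :
    wordInv l (fun l' => - g l') = - wordInv l g :=
  (map_wordInv (negAddMonoidHom : M →+ M) l g).symm

theorem wordInv_sub (l : List F) (g h : List F → M) :
    wordInv l (fun l' => g l' - h l') = wordInv l g - wordInv l h := by
  simp only [sub_eq_add_neg, wordInv_add, wordInv_neg]

theorem wordInv_zero (l : List F) : wordInv l (fun _ => (0 : M)) = 0 := by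
  simpa using wordInv_sub l (fun _ => (0 : M)) fun _ => 0

theorem wordInv_sum {ι : Type*} (s : Finset ι) (l : List F) (g : ι → List F → M) :
    wordInv l (fun l' => ∑ i ∈ s, g i l') = ∑ i ∈ s, wordInv l (g i) := by
  classical
  induction s using Finset.induction_on with
  | empty => simpa using wordInv_zero l
  | insert a s ha ih => simp only [Finset.sum_insert ha, wordInv_add, ih]

theorem wordInv_append (l₁ l₂ : List F) (g : List F → M) :
    wordInv (l₁ ++ l₂) g = wordInv l₁ fun a => wordInv l₂ fun b => g (a ++ b) := by
  induction l₁ generalizing g with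
  | nil => rfl
  | cons x l ih => simp only [List.cons_append, wordInv, ih]

theorem letterInv_wordInv_comm (x : F) (l : List F) (g : F → List F → M) :
    letterInv x (fun u => wordInv l (g u)) = wordInv l fun l' => letterInv x fun u => g u l' := by
  unfold letterInv
  rw [wordInv_sub]
  split_ifs <;> simp [wordInv_zero]

theorem wordInv_comm (l₁ l₂ : List F) (g : List F → List F → M) :
    wordInv l₁ (fun a => wordInv l₂ (g a)) = wordInv l₂ fun b => wordInv l₁ fun a => g a b := by
  induction l₁ generalizing g with
  | nil => rfl
  | cons x l ih => simp only [wordInv, ih, letterInv_wordInv_comm]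

/-- A field embedding preserves inverses and detects zero. This is used for the constants F → F(t).
-/
theorem wordInv_map {K : Type*} [Field K] (f : K →+* F) (l : List K) (g : List F → M) :
    wordInv (l.map f) g = wordInv l fun l' => g (l'.map f) := by
  induction l generalizing g with
  | nil => rfl
  | cons x l ih =>
    by_cases h : x = 0 <;>
      simp [wordInv, ih, letterInv, h]

variable [Module ℚ M] [Module ℚ N]

theorem wordInv_tmul_left (l : List F) (g : List F → M) (b : N) :
    wordInv l (fun l' => g l' ⊗ₜ[ℚ] b) = wordInv l g ⊗ₜ[ℚ] b :=
  (map_wordInv ((TensorProduct.mk ℚ M N).flip b).toAddMonoidHom l g).symm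

theorem wordInv_tmul_right (l : List F) (a : M) (g : List F → N) :
    wordInv l (fun l' => a ⊗ₜ[ℚ] g l') = a ⊗ₜ[ℚ] wordInv l g :=
  (map_wordInv (TensorProduct.mk ℚ M N a).toAddMonoidHom l g).symm

theorem wordInv_tmul (l₁ l₂ : List F) (g : List F → M) (h : List F → N) :
    wordInv l₁ (fun a => wordInv l₂ fun b => g a ⊗ₜ[ℚ] h b) =
      wordInv l₁ g ⊗ₜ[ℚ] wordInv l₂ h := by
  simp only [wordInv_tmul_right, wordInv_tmul_left]

end wordInv

/-! ### Cyclic symmetry and the cobracket of words -/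

theorem wd_rotate {p : ℕ} (f : ℕ → F) (k : ℕ) (hk : k ≤ p) :
    wd p (fun a => if a + k ≤ p then f (a + k) else f (a + k - p - 1)) = wd p f := by
  induction k with
  | zero => exact wd_congr fun a ha => by simp [ha]
  | succ k ih =>
    rw [← ih (by omega), ← wd_rot p (fun a => if a + k ≤ p then f (a + k) else f (a + k - p - 1))]
    refine wd_congr fun a ha => ?_
    by_cases h1 : a = p
    · subst h1
      rw [if_neg (by omega), if_pos rfl, if_pos (by omega)]
      congr 1; omega
    · rw [if_neg h1]
      by_cases h2 : a + (k + 1) ≤ p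
      · rw [if_pos h2, if_pos (by omega)]; congr 1; omega
      · rw [if_neg h2, if_neg (by omega)]; congr 1; omega

theorem wordSym_append_comm {n : ℕ} {l₁ l₂ : List F} (h : (l₁ ++ l₂).length = n + 1) :
    wordSym n (l₁ ++ l₂) = wordSym n (l₂ ++ l₁) := by
  rw [List.length_append] at h
  rcases Nat.eq_zero_or_pos l₂.length with h2 | h2
  · simp [List.length_eq_zero_iff.1 h2]
  unfold wordSym
  rw [← wd_rotate (fun i => (l₁ ++ l₂).getD i 0) l₁.length (by omega)]
  refine wd_congr fun a ha => ?_
  split_ifs with h3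
  · rw [List.getD_append_right _ _ _ _ (by omega), List.getD_append _ _ _ _ (by omega)]
    congr 1; omega
  · rw [List.getD_append _ _ _ _ (by omega), List.getD_append_right _ _ _ _ (by omega)]
    congr 1; omega

theorem wordCor_append_comm {n : ℕ} {l₁ l₂ : List F} (h : (l₁ ++ l₂).length = n + 1) :
    wordCor n (l₁ ++ l₂) = wordCor n (l₂ ++ l₁) := by
  rw [wordCor, wordCor, wordSym_append_comm h]

section cutPart
variable {P Q : Type*} [AddCommGroup P] [AddCommGroup Q] [Module ℚ P] [Module ℚ Q]

/-- The terms of the cobracket of the cyclic word `z X` that put into the first factor a segment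
of `X`, or the initial segment of `z X`. -/
def cutPart (u : List F → P) (v : List F → Q) (p q : ℕ) (z : F) (X : List F) : P ⊗[ℚ] Q :=
  u (z :: X.take p) ⊗ₜ v (z :: X.drop p) +
    ∑ a ∈ Finset.range q, u ((X.drop a).take (p + 1)) ⊗ₜ
      (v (z :: (X.take (a + 1) ++ X.drop (a + p + 1))) - v (z :: (X.take a ++ X.drop (a + p))))

theorem map_cutPart {P' Q' : Type*} [AddCommGroup P'] [AddCommGroup Q'] [Module ℚ P']
    [Module ℚ Q'] {K : Type*} (f : P →ₗ[ℚ] P') (g : Q →ₗ[ℚ] Q') (u : List K → P) (v : List K → Q) (p q : ℕ)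
    (z : K) (X : List K) :
    TensorProduct.map f g (cutPart u v p q z X) =
      cutPart (fun l => f (u l)) (fun l => g (v l)) p q z X := by
  simp [cutPart, map_sum]

end cutPart

theorem getD_cons_take_append_drop {a b i : ℕ} (z : F) {X : List F} (ha : a ≤ X.length) :
    (z :: (X.take a ++ X.drop b)).getD i 0 =
      if i ≤ a then (z :: X).getD i 0 else (z :: X).getD (i - a + b) 0 := by
  rcases i with _ | i
  · simp
  · have e : i + 1 - a + b = (i - a + b) + 1 ∨ i + 1 ≤ a := by omega
    split_ifs with h
    · simp only [List.getD_cons_succ]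
      rw [List.getD_append _ _ _ _ (by simp; omega)]
      simp only [List.getD_eq_getElem?_getD, List.getElem?_take]
      rw [if_pos (by omega)]
    · rw [e.resolve_right (by omega)]
      simp only [List.getD_cons_succ]
      rw [List.getD_append_right _ _ _ _ (by simp; omega)]
      simp only [List.getD_eq_getElem?_getD, List.getElem?_drop, List.length_take,
        min_eq_left ha]
      congr 2; omega

theorem getD_take_drop {a p i : ℕ} (z : F) {X : List F} (hi : i ≤ p) :
    ((X.drop a).take (p + 1)).getD i 0 = (z :: X).getD (a + 1 + i) 0 := by
  rw [show a + 1 + i = a + i + 1 by omega]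
  simp only [List.getElem?_cons_succ, List.getD_eq_getElem?_getD, List.getElem?_take,
    List.getElem?_drop]
  rw [if_pos (by omega)]

/-- Each cut of the cyclic word gives two arcs sharing one letter. If that letter is not z, exactly
one arc avoids z and is a segment of X, sharing its first or its last letter with the other arc.
Sorting the cuts by the factor that receives this segment gives `cutPart` and its mirror image. -/
theorem cobracketFun_word {p q : ℕ} (z : F) {X : List F} (hX : X.length = p + q) :
    cobracketFun p q (fun i : Fin (p + q + 1) => (z :: X).getD i 0) =
      cutPart (wordSym p) (wordSym q) p q z X -
        TensorProduct.comm ℚ _ _ (cutPart (wordSym q) (wordSym p) q p z X) := by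
  set x := fun i : Fin (p + q + 1) => (z :: X).getD i 0 with hx
  have hper : ∀ i, i ≤ 2 * (p + q) + 1 → per x i =
      if i ≤ p + q then (z :: X).getD i 0 else (z :: X).getD (i - (p + q) - 1) 0 := by
    intro i hi
    simp only [hx, per, Fin.ofNat]
    split_ifs with h
    · rw [Nat.mod_eq_of_lt (by omega)]
    · rw [Nat.mod_eq_sub_mod (by omega), Nat.mod_eq_of_lt (by omega), Nat.sub_sub]
  have h1 : ∀ p' q', p' + q' = p + q → cutL x p' 0 = wordSym p' (z :: X.take p') := by
    intro p' q' h
    refine wd_congr fun i hi => ?_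
    have := getD_cons_take_append_drop (i := i) (b := X.length) z (X := X) (a := p') (by omega)
    rw [List.drop_length, List.append_nil, if_pos hi] at this
    rw [this, hper _ (by omega), if_pos (by omega), zero_add]
  have h2 : ∀ p' q', p' + q' = p + q → cutR x p' q' 0 = wordSym q' (z :: X.drop p') := by
    intro p' q' h
    refine wd_congr fun i hi => ?_
    have := getD_cons_take_append_drop (i := i) (b := p') z (X := X) (a := 0) (by omega)
    rw [List.take_zero, List.nil_append] at this
    rw [this, hper _ (by omega), hper _ (by omega)]
    rcases i with _ | i
    · simp
    · simp only [Nat.add_eq_zero_iff, one_ne_zero, and_false, if_false]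
      rw [if_pos (by omega), if_neg (by omega)]; congr 1; omega
  have h3 : ∀ p' q' a, p' + q' = p + q → a < q' →
      cutL x p' (a + 1) = wordSym p' ((X.drop a).take (p' + 1)) := by
    intro p' q' a h ha
    refine wd_congr fun i hi => ?_
    rw [getD_take_drop z hi, hper _ (by omega), if_pos (by omega)]
  have h4 : ∀ p' q' a, p' + q' = p + q → a < q' → cutR x p' q' (a + 1) =
      wordSym q' (z :: (X.take (a + 1) ++ X.drop (a + p' + 1))) := by
    intro p' q' a h ha
    unfold wordSym cutR
    rw [← wd_rotate (fun i => (z :: (X.take (a + 1) ++ X.drop (a + p' + 1))).getD i 0) (a + 1)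
      (by omega)]
    refine wd_congr fun i hi => ?_
    simp only [getD_cons_take_append_drop z (X := X) (a := a + 1) (by omega)]
    rw [hper _ (by omega), hper _ (by omega)]
    split_ifs <;> first | omega | (congr 1; omega)
  have h5 : ∀ p' q' a, p' + q' = p + q → a < p' → cutL x p' (q' + a + 1) =
      wordSym p' (z :: (X.take a ++ X.drop (a + q'))) := by
    intro p' q' a h ha
    unfold wordSym cutL
    rw [← wd_rotate (fun i => (z :: (X.take a ++ X.drop (a + q'))).getD i 0) (a + 1)
      (by omega)]
    refine wd_congr fun i hi => ?_
    simp only [getD_cons_take_append_drop z (X := X) (a := a) (by omega)]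
    rw [hper _ (by omega)]
    split_ifs <;> first | omega | (congr 1; omega)
  have h6 : ∀ p' q' a, p' + q' = p + q → a < p' → cutR x p' q' (q' + a + 1) =
      wordSym q' ((X.drop a).take (q' + 1)) := by
    intro p' q' a h ha
    unfold wordSym cutR
    rw [← wd_rotate (fun i => ((X.drop a).take (q' + 1)).getD i 0) q' le_rfl]
    refine wd_congr fun i hi => ?_
    rw [hper _ (by omega), hper _ (by omega)]
    split_ifs <;> first
      | omega
      | (rw [getD_take_drop z (by omega)]; congr 1; omega)
  unfold cobracketFun cutPart
  rw [Finset.sum_range_succ', h1 p q rfl, h1 q p (by omega), h2 p q rfl, h2 q p (by omega),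
    Finset.sum_sub_distrib]
  -- The two sums break at different positions: an arc starting in X with p + 1 letters avoids z for
  -- q starting positions, one with q + 1 letters for p of them.
  nth_rewrite 1 [show p + q = q + p by omega]
  rw [Finset.sum_range_add, Finset.sum_range_add]
  have e1 : ∀ a ∈ Finset.range q, cutL x p (a + 1) ⊗ₜ[ℚ] cutR x p q (a + 1) = _ := fun a ha => by
    rw [h3 p q a rfl (Finset.mem_range.1 ha), h4 p q a rfl (Finset.mem_range.1 ha)]
  have e2 : ∀ a ∈ Finset.range p, cutL x p (q + a + 1) ⊗ₜ[ℚ] cutR x p q (q + a + 1) = _ :=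
    fun a ha => by
      rw [h5 p q a rfl (Finset.mem_range.1 ha), h6 p q a rfl (Finset.mem_range.1 ha)]
  have e3 : ∀ a ∈ Finset.range p, cutR x q p (a + 1) ⊗ₜ[ℚ] cutL x q (a + 1) = _ := fun a ha => by
    rw [h3 q p a (by omega) (Finset.mem_range.1 ha), h4 q p a (by omega) (Finset.mem_range.1 ha)]
  have e4 : ∀ a ∈ Finset.range q, cutR x q p (p + a + 1) ⊗ₜ[ℚ] cutL x q (p + a + 1) = _ :=
    fun a ha => by
      rw [h5 q p a (by omega) (Finset.mem_range.1 ha), h6 q p a (by omega) (Finset.mem_range.1 ha)]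
  rw [Finset.sum_congr rfl e1, Finset.sum_congr rfl e2, Finset.sum_congr rfl e3,
    Finset.sum_congr rfl e4]
  simp only [map_add, map_sub, map_sum, TensorProduct.comm_tmul, TensorProduct.tmul_sub,
    Finset.sum_sub_distrib]
  abel

theorem cobracket_word {n p q : ℕ} (h : p + q = n) (z : F) {X : List F} (hX : X.length = n) :
    TensorProduct.map (relSpace p F).mkQ (relSpace q F).mkQ
        (cobracket h (wordSym n (z :: X))) =
      cutPart (wordCor p) (wordCor q) p q z X -
        TensorProduct.comm ℚ _ _ (cutPart (wordCor q) (wordCor p) q p z X) := by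
  subst h
  have : cobracket rfl (wordSym (p + q) (z :: X)) = cobracketFun p q _ := liftA_sym _ _ _
  rw [this, cobracketFun_word z hX, map_sub, TensorProduct.map_comm, map_cutPart, map_cutPart]
  rfl


/-! ### Compatibility of the inversion substitution with the cobracket. -/

section
variable {P Q : Type*} [AddCommGroup P] [AddCommGroup Q] [Module ℚ P] [Module ℚ Q]

/-- A shared letter is substituted simultaneously in both factors, so the result is not a product of
substitutions; the extra term w ⊗ g(0) measures the failure. The hypotheses on f are the two
inversion formulas for the left factor. -/
theorem letterInv_tmul {s : F} {f : F → P} {g : F → Q} {w w₀ : P} (h : s ≠ 0 → f s⁻¹ = w - w₀)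
    (h₀ : f 0 = -w₀) (hs : s = 0 → w = w₀) :
    letterInv s (fun t => f t ⊗ₜ[ℚ] g t) = (w - w₀) ⊗ₜ letterInv s g + w ⊗ₜ g 0 := by
  unfold letterInv
  by_cases h0 : s = 0
  · simp [h0, h₀, hs h0, TensorProduct.neg_tmul]
  · simp only [h0, if_false, h h0, h₀, TensorProduct.neg_tmul, TensorProduct.sub_tmul,
      TensorProduct.tmul_sub]
    abel

/-- The substitution `wordInv` applied to `u (s S) ⊗ v (c A s B)`, where the letter `s` is shared by
the two factors. -/
def sharedInv (u : List F → P) (v : List F → Q) (c s : F) (S A B : List F) : P ⊗[ℚ] Q :=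
  letterInv s fun t => wordInv S (fun S' => u (t :: S')) ⊗ₜ
    wordInv A fun A' => wordInv B fun B' => v (c :: (A' ++ t :: B'))

theorem wordInv_keep_first (u : List F → P) (v : List F → Q) (c s : F) {S A : List F}
    (B : List F) {a p : ℕ} (hA : A.length = a) (hS : S.length = p) :
    wordInv (A ++ (s :: S ++ B)) (fun X => u ((X.drop a).take (p + 1)) ⊗ₜ[ℚ]
      v (c :: (X.take (a + 1) ++ X.drop (a + p + 1)))) = sharedInv u v c s S A B := by
  have : wordInv (A ++ (s :: S ++ B)) (fun X => u ((X.drop a).take (p + 1)) ⊗ₜ[ℚ]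
      v (c :: (X.take (a + 1) ++ X.drop (a + p + 1)))) =
      wordInv A fun A' => letterInv s fun t => wordInv S fun S' => wordInv B fun B' =>
        u (t :: S') ⊗ₜ[ℚ] v (c :: (A' ++ t :: B')) := by
    rw [wordInv_append]
    refine wordInv_congr fun A' hA' => ?_
    rw [wordInv_append, wordInv]
    congr 1; funext t
    refine wordInv_congr fun S' hS' => wordInv_congr fun B' _ => ?_
    rw [hA] at hA'; rw [hS] at hS'
    have h1 : A' ++ (t :: S' ++ B') = (A' ++ [t]) ++ (S' ++ B') := by simp
    have h2 : A' ++ (t :: S' ++ B') = (A' ++ t :: S') ++ B' := by simp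
    rw [List.drop_left' hA', List.take_left' (by simp [hS'])]
    nth_rewrite 1 [h1]
    rw [h2, List.take_left' (by simp [hA']), List.drop_left' (by simp [hA', hS']; omega)]
    simp
  rw [this, ← letterInv_wordInv_comm]
  unfold sharedInv
  congr 1; funext t
  rw [wordInv_comm]
  simp only [wordInv_tmul_right, wordInv_tmul_left]

/-- Cyclic invariance `hu` moves the shared last letter to the front, which gives the same normal
form as for a shared first letter. -/
theorem wordInv_keep_last (u : List F → P) (v : List F → Q) (c s : F) {S A : List F}
    (B : List F) {a p : ℕ} (hA : A.length = a) (hS : S.length = p)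
    (hu : ∀ S' t, S'.length = p → u (S' ++ [t]) = u (t :: S')) :
    wordInv (A ++ (S ++ s :: B)) (fun X => u ((X.drop a).take (p + 1)) ⊗ₜ[ℚ]
      v (c :: (X.take a ++ X.drop (a + p)))) = sharedInv u v c s S A B := by
  have : wordInv (A ++ (S ++ s :: B)) (fun X => u ((X.drop a).take (p + 1)) ⊗ₜ[ℚ]
      v (c :: (X.take a ++ X.drop (a + p)))) =
      wordInv A fun A' => wordInv S fun S' => letterInv s fun t => wordInv B fun B' =>
        u (t :: S') ⊗ₜ[ℚ] v (c :: (A' ++ t :: B')) := by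
    rw [wordInv_append]
    refine wordInv_congr fun A' hA' => ?_
    rw [wordInv_append]
    refine wordInv_congr fun S' hS' => ?_
    rw [wordInv]
    congr 1; funext t
    refine wordInv_congr fun B' _ => ?_
    rw [hA] at hA'; rw [hS] at hS'
    have h1 : S' ++ t :: B' = (S' ++ [t]) ++ B' := by simp
    have h2 : A' ++ (S' ++ t :: B') = (A' ++ S') ++ t :: B' := by simp
    rw [List.drop_left' hA', List.take_left' hA']
    nth_rewrite 1 [h1]
    rw [h2, List.take_left' (by simp [hS']), List.drop_left' (by simp [hA', hS']), hu _ _ hS']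
  simp only [this, ← letterInv_wordInv_comm]
  unfold sharedInv
  congr 1; funext t
  rw [wordInv_comm]
  simp only [wordInv_tmul_right, wordInv_tmul_left]

end

/-- The inversion formula for correlators of weight `n` with a distinguished letter `z ≠ 0`. -/
def InvFormula (n : ℕ) (F : Type u) [Field F] : Prop :=
  ∀ (z : F) (X : List F), z ≠ 0 → X.length = n → (n = 1 → z ∉ X) →
    wordInv X (fun X' => wordCor n (z⁻¹ :: X')) = wordCor n (z :: X) - wordCor n (0 :: X)

/-- The inversion formula for correlators of weight `n` with the distinguished letter `∞`. -/
def InvFormulaInfty (n : ℕ) (F : Type u) [Field F] : Prop :=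
  ∀ X : List F, X.length = n → wordInv X (fun X' => wordCor n (0 :: X')) = - wordCor n (0 :: X)

theorem sharedInv_wordCor {p q : ℕ} (h : InvFormula p F) (h' : InvFormulaInfty p F) {s : F}
    {S : List F} (hS : S.length = p) (hs : p = 1 → s ∉ S) (c : F) (A B : List F) :
    sharedInv (wordCor p) (wordCor q) c s S A B =
      (wordCor p (s :: S) - wordCor p (0 :: S)) ⊗ₜ
          wordInv (A ++ s :: B) (fun X => wordCor q (c :: X)) +
        wordCor p (s :: S) ⊗ₜ
          wordInv A fun A' => wordInv B fun B' => wordCor q (c :: (A' ++ 0 :: B')) := by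
  unfold sharedInv
  rw [letterInv_tmul (fun h0 => h s S h0 hS hs) (h' S hS) (fun h0 => by rw [h0]),
    wordInv_append]
  simp only [wordInv, ← letterInv_wordInv_comm]

/-- The same segment is cut out once with its first and once with its last letter shared. The
correction terms of `letterInv_tmul` are then equal: the left factors agree by cyclicity, and the
right factors both come from putting 0 between A and B. They cancel. -/
theorem sharedInv_sub {p q : ℕ} (h : InvFormula p F) (h' : InvFormulaInfty p F) {s s' : F}
    {S S' : List F} (hS : S.length = p) (hS' : S'.length = p) (hss : s :: S = S' ++ [s'])
    (c : F) (A B : List F) {I : List F → L q F}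
    (hI : wordInv (A ++ s :: B) (fun X => wordCor q (c :: X)) = I (A ++ s :: B))
    (hI' : wordInv (A ++ s' :: B) (fun X => wordCor q (c :: X)) = I (A ++ s' :: B)) :
    sharedInv (wordCor p) (wordCor q) c s S A B - sharedInv (wordCor p) (wordCor q) c s' S' A B =
      wordCor p (s :: S) ⊗ₜ (I (A ++ s :: B) - I (A ++ s' :: B)) +
        (wordCor p (0 :: S') ⊗ₜ I (A ++ s' :: B) - wordCor p (0 :: S) ⊗ₜ I (A ++ s :: B)) := by
  have hc : wordCor p (s' :: S') = wordCor p (s :: S) := by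
    rw [hss, wordCor_append_comm (by simp [hS'])]; rfl
  -- In weight 1 `InvFormula` fails when z = x: the two sides are log z and -log z. But a segment
  -- with two equal letters gives the same term for either choice of shared letter, so both sides
  -- are zero.
  by_cases hp : p = 1
  · obtain ⟨y, rfl⟩ := List.length_eq_one_iff.1 (hS.trans hp)
    obtain ⟨y', rfl⟩ := List.length_eq_one_iff.1 (hS'.trans hp)
    obtain ⟨rfl, rfl⟩ : s = y' ∧ y = s' := by simpa using hss
    by_cases hsy : s = y
    · subst hsy; simp
    · rw [sharedInv_wordCor h h' hS (fun _ => by simpa using hsy),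
        sharedInv_wordCor h h' hS' (fun _ => by simpa using Ne.symm hsy), hI, hI', hc]
      simp only [TensorProduct.tmul_sub, TensorProduct.sub_tmul]
      abel
  · rw [sharedInv_wordCor h h' hS (fun e => (hp e).elim),
      sharedInv_wordCor h h' hS' (fun e => (hp e).elim), hI, hI', hc]
    simp only [TensorProduct.tmul_sub, TensorProduct.sub_tmul]
    abel

/-- The terms of `sharedInv_sub` that contain cor(0, S) telescope as the segment slides along X. The
boundary terms left over are unchanged when p, q and the tensor factors are swapped, so they
disappear from the antisymmetric cobracket. -/
theorem wordInv_cutPart {p q : ℕ} (hp : InvFormula p F) (hp' : InvFormulaInfty p F)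
    (hq : InvFormula q F) {z : F} {X : List F} (hz : z ≠ 0) (hzX : z ∉ X)
    (hX : X.length = p + q) :
    wordInv X (fun X' => cutPart (wordCor p) (wordCor q) p q z⁻¹ X') =
      cutPart (wordCor p) (wordCor q) p q z X - cutPart (wordCor p) (wordCor q) p q 0 X -
        ((wordCor p (z :: X.take p) - wordCor p (0 :: X.take p)) ⊗ₜ wordCor q (0 :: X.drop p) +
          wordCor p (0 :: X.drop q) ⊗ₜ
            (wordCor q (z :: X.take q) - wordCor q (0 :: X.take q))) := by
  let I : List F → L q F := fun Y => wordCor q (z :: Y) - wordCor q (0 :: Y)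
  have hI : ∀ Y : List F, Y ⊆ X → Y.length = q →
      wordInv Y (fun X => wordCor q (z⁻¹ :: X)) = I Y :=
    fun Y hY hl => hq z Y hz hl fun _ h => hzX (hY h)
  -- The telescoping quantity: p consecutive letters starting at position a are removed from X.
  let M : ℕ → L p F ⊗[ℚ] L q F := fun a =>
    wordCor p (0 :: (X.drop a).take p) ⊗ₜ I (X.take a ++ X.drop (a + p))
  have h0 : wordInv X (fun X' =>
      wordCor p (z⁻¹ :: X'.take p) ⊗ₜ[ℚ] wordCor q (z⁻¹ :: X'.drop p)) =
      (wordCor p (z :: X.take p) - wordCor p (0 :: X.take p)) ⊗ₜ I (X.drop p) := by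
    rw [← hI _ (List.drop_subset _ _) (by simp; omega), ← hp z (X.take p) hz (by simp; omega)
      (fun _ h => hzX (List.take_subset _ _ h)), ← wordInv_tmul]
    conv_lhs => rw [← List.take_append_drop p X]
    rw [wordInv_append]
    refine wordInv_congr fun A hA => wordInv_congr fun B _ => ?_
    have hA : A.length = p := by rw [hA]; simp; omega
    rw [List.take_left' hA, List.drop_left' hA]
  have h1 : ∀ a ∈ Finset.range q, wordInv X (fun X' =>
      wordCor p ((X'.drop a).take (p + 1)) ⊗ₜ[ℚ]
        (wordCor q (z⁻¹ :: (X'.take (a + 1) ++ X'.drop (a + p + 1))) -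
          wordCor q (z⁻¹ :: (X'.take a ++ X'.drop (a + p))))) =
      wordCor p ((X.drop a).take (p + 1)) ⊗ₜ[ℚ]
        (I (X.take (a + 1) ++ X.drop (a + p + 1)) - I (X.take a ++ X.drop (a + p))) +
        (M a - M (a + 1)) := by
    intro a ha
    have ha := Finset.mem_range.1 ha
    obtain ⟨s, hs⟩ : ∃ s, X.drop a = s :: X.drop (a + 1) :=
      ⟨X[a]'(by omega), List.drop_eq_getElem_cons (by omega)⟩
    obtain ⟨s', hs'⟩ : ∃ s', X.drop (a + p) = s' :: X.drop (a + p + 1) :=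
      ⟨X[a + p]'(by omega), List.drop_eq_getElem_cons (by omega)⟩
    set A := X.take a with hA
    set B := X.drop (a + p + 1) with hB
    set S := (X.drop (a + 1)).take p with hS
    set S' := (X.drop a).take p with hS'
    have lA : A.length = a := by simp [hA]; omega
    have lS : S.length = p := by simp [hS]; omega
    have lS' : S'.length = p := by simp [hS']; omega
    have d1 : (X.drop a).take (p + 1) = s :: S := by rw [hs, List.take_succ_cons]
    have d2 : (X.drop a).take (p + 1) = S' ++ [s'] := by
      rw [List.take_add, List.drop_drop, hs']; rfl
    have d3 : X.take (a + 1) = A ++ [s] := by rw [List.take_add, hs]; rfl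
    have x1 : X = A ++ (s :: S ++ B) := by
      rw [← d1, hA, hB, add_assoc, ← List.drop_drop, List.take_append_drop,
        List.take_append_drop]
    have x2 : X = A ++ (S' ++ s' :: B) := by
      rw [← hs', hA, hS', ← List.drop_drop, List.take_append_drop, List.take_append_drop]
    have hI1 := hI (A ++ s :: B) (by rw [x1]; intro y; simp; tauto)
      (by simp [lA, hB]; omega)
    have hI2 := hI (A ++ s' :: B) (by rw [x2]; intro y; simp; tauto)
      (by simp [lA, hB]; omega)
    have key := sharedInv_sub hp hp' lS lS' (d1.symm.trans d2) z⁻¹ A B hI1 hI2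
    rw [← wordInv_keep_first _ _ _ _ _ lA lS, ← x1, ← wordInv_keep_last _ _ _ _ _ lA lS'
      (fun S' t h => wordCor_append_comm (by simp [h])), ← x2, ← wordInv_sub] at key
    simp only [TensorProduct.tmul_sub] at key ⊢
    rw [key, d1]
    simp only [M]
    rw [d3, hs', show a + 1 + p = a + p + 1 by omega, ← hS, ← hS', ← hA, ← hB]
    simp
  unfold cutPart
  rw [wordInv_add, wordInv_sum, h0, Finset.sum_congr rfl h1, Finset.sum_add_distrib,
    Finset.sum_range_sub']
  have m0 : M 0 = wordCor p (0 :: X.take p) ⊗ₜ I (X.drop p) := by simp [M]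
  have mq : M q = wordCor p (0 :: X.drop q) ⊗ₜ I (X.take q) := by
    simp only [M]
    rw [List.take_of_length_le (i := p) (by simp; omega), List.drop_of_length_le (i := q + p)
      (by omega), List.append_nil]
  rw [m0, mq]
  simp only [I, TensorProduct.tmul_sub, TensorProduct.sub_tmul, Finset.sum_sub_distrib]
  abel

/-- The inversion formula in `𝒜_n(F)`, as the difference of its two sides. -/
def invDefect (n : ℕ) (z : F) (X : List F) : A n F :=
  wordSym n (z :: X) - wordSym n (0 :: X) - wordInv X fun X' => wordSym n (z⁻¹ :: X')

theorem cobracket_invDefect {n p q : ℕ} (h : p + q = n) (hp : InvFormula p F)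
    (hp' : InvFormulaInfty p F) (hq : InvFormula q F) (hq' : InvFormulaInfty q F) {z : F}
    {X : List F} (hz : z ≠ 0) (hzX : z ∉ X) (hX : X.length = n) :
    TensorProduct.map (relSpace p F).mkQ (relSpace q F).mkQ
      (cobracket h (invDefect n z X)) = 0 := by
  have key := map_wordInv ((TensorProduct.map (relSpace p F).mkQ (relSpace q F).mkQ).comp
    (cobracket h)).toAddMonoidHom X fun X' => wordSym n (z⁻¹ :: X')
  simp only [LinearMap.toAddMonoidHom_coe, LinearMap.comp_apply] at key
  rw [wordInv_congr fun X' hX' => cobracket_word h z⁻¹ (hX'.trans hX), wordInv_sub] at key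
  have hcomm := map_wordInv
    (TensorProduct.comm ℚ (L q F) (L p F)).toLinearMap.toAddMonoidHom X
    fun X' => cutPart (wordCor q) (wordCor p) q p z⁻¹ X'
  simp only [LinearMap.toAddMonoidHom_coe, LinearEquiv.coe_coe] at hcomm
  rw [← hcomm, wordInv_cutPart hp hp' hq hz hzX (by omega),
    wordInv_cutPart hq hq' hp hz hzX (by omega)] at key
  unfold invDefect
  rw [map_sub, map_sub, map_sub, map_sub, key, cobracket_word h z hX, cobracket_word h 0 hX]
  simp only [map_sub, map_add, TensorProduct.comm_tmul]
  abel


/-! ### Specialization of words with one nonconstant letter -/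

/-- Translation and scaling reduce the tuple to (1, 0, …, 0) or to a constant one; scaling is where
n ≥ 2 enters. -/
theorem sym_zero_const {n : ℕ} (hn : 2 ≤ n) (y : F) :
    sym (fun i : Fin (n + 1) => if i = 0 then 0 else y) = 0 := by
  rw [← sym_translate _ (-y)]
  by_cases hy : y = 0
  · rw [← sym_const (F := F) (n := n) 0]; congr 1; funext i; simp [hy]
  · rw [← sym_one (F := F) (n := n),
      ← sym_scale hn (fun i => if i = 0 then (1 : F) else 0) (Units.mk0 (-y) (neg_ne_zero.2 hy))]
    congr 1; funext i; split_ifs <;> simp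

open scoped RatFunc in
theorem expandAt_C (a c : F) : expandAt a (RatFunc.C c) = HahnSeries.C c := by
  have : expandAt a (RatFunc.C c) =
      algebraMap (RatFunc F) (LaurentSeries F) (RatFunc.laurent a (RatFunc.C c)) := rfl
  rw [this, RatFunc.laurent_C, ← RatFunc.algebraMap_C]
  have h := RatFunc.coe_coe (F := F) (Polynomial.C c)
  rw [Polynomial.coe_C, PowerSeries.coe_C] at h
  exact h.symm

open scoped RatFunc in
theorem expandAt_X (a : F) :
    expandAt a RatFunc.X = HahnSeries.single 1 1 + HahnSeries.C a := by
  have : expandAt a (RatFunc.X : RatFunc F) =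
      algebraMap (RatFunc F) (LaurentSeries F) (RatFunc.laurent a RatFunc.X) := rfl
  rw [this, RatFunc.laurent_X, map_add, RatFunc.coe_X]
  congr 1
  have h := expandAt_C 0 a
  rw [show expandAt 0 (RatFunc.C a) =
      algebraMap (RatFunc F) (LaurentSeries F) (RatFunc.laurent 0 (RatFunc.C a)) from rfl,
    RatFunc.laurent_C] at h
  exact h

/-- `f` is regular at `a`, with value `v`. -/
def HasValueAt (a : F) (f : RatFunc F) (v : F) : Prop :=
  (∀ r < 0, (expandAt a f).coeff r = 0) ∧ (expandAt a f).coeff 0 = v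

/-- `f` has a pole at `a`. -/
def HasPoleAt (a : F) (f : RatFunc F) : Prop := ∃ r < 0, (expandAt a f).coeff r ≠ 0

theorem hasValueAt_C (a c : F) : HasValueAt a (RatFunc.C c) c := by
  refine ⟨fun r hr => ?_, ?_⟩ <;> rw [expandAt_C]
  · exact HahnSeries.coeff_single_of_ne hr.ne
  · exact HahnSeries.coeff_single_same _ _

theorem HasPoleAt.ne_C {a : F} {f : RatFunc F} (h : HasPoleAt a f) (c : F) : f ≠ RatFunc.C c := by
  rintro rfl
  obtain ⟨r, hr, h⟩ := h
  exact h ((hasValueAt_C a c).1 r hr)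

theorem hasValueAt_X_mul_C (a c : F) : HasValueAt a (RatFunc.X * RatFunc.C c) (a * c) := by
  have : expandAt a (RatFunc.X * RatFunc.C c) =
      HahnSeries.single 1 c + HahnSeries.single 0 (a * c) := by
    rw [map_mul, expandAt_X, expandAt_C, add_mul, HahnSeries.C_apply, HahnSeries.C_apply,
      HahnSeries.single_mul_single, HahnSeries.single_mul_single]
    simp
  refine ⟨fun r hr => ?_, ?_⟩ <;> rw [this, HahnSeries.coeff_add]
  · rw [HahnSeries.coeff_single_of_ne (by omega), HahnSeries.coeff_single_of_ne (by omega),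
      add_zero]
  · rw [HahnSeries.coeff_single_of_ne (by omega), HahnSeries.coeff_single_same, zero_add]

theorem HasValueAt.inv {a v : F} {f : RatFunc F} (h : HasValueAt a f v) (hv : v ≠ 0) :
    HasValueAt a f⁻¹ v⁻¹ := by
  obtain ⟨h1, h2⟩ := h
  set g := expandAt a f with hg
  have hg0 : g ≠ 0 := fun e => hv (by rw [← h2, e]; rfl)
  have ho : g.order = 0 := by
    refine le_antisymm (HahnSeries.order_le_of_coeff_ne_zero (by rwa [h2])) (not_lt.1 fun h => ?_)
    exact hg0 (HahnSeries.coeff_order_eq_zero.1 (h1 _ h))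
  have hmul : g * g⁻¹ = 1 := mul_inv_cancel₀ hg0
  have ho' : g⁻¹.order = 0 := by
    have := HahnSeries.order_mul hg0 (inv_ne_zero hg0)
    rw [hmul, HahnSeries.order_one, ho, zero_add] at this
    exact this.symm
  have hl : g.leadingCoeff * g⁻¹.leadingCoeff = 1 := by
    rw [← HahnSeries.leadingCoeff_mul, hmul, HahnSeries.leadingCoeff_one]
  rw [HahnSeries.leadingCoeff_eq, HahnSeries.leadingCoeff_eq, ho, ho', h2] at hl
  refine ⟨fun r hr => ?_, ?_⟩ <;> rw [map_inv₀, ← hg]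
  · exact HahnSeries.coeff_eq_zero_of_lt_order (by rw [ho']; exact hr)
  · exact (inv_eq_of_mul_eq_one_right hl).symm

theorem hasPoleAt_inv_X_mul_C {c : F} (hc : c ≠ 0) :
    HasPoleAt 0 (RatFunc.X * RatFunc.C c)⁻¹ := by
  refine ⟨-1, by norm_num, ?_⟩
  rw [map_inv₀, map_mul, expandAt_X, expandAt_C, map_zero, add_zero, HahnSeries.C_apply,
    HahnSeries.single_mul_single, HahnSeries.inv_single, one_mul, add_zero,
    HahnSeries.coeff_single_same]
  exact inv_ne_zero hc

theorem spTuple_cons {n : ℕ} (a : F) (f : RatFunc F) (y : Fin (n + 1) → F) (i : Fin (n + 1)) :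
    spTuple a (fun i => if i = 0 then f else RatFunc.C (y i)) i =
      if i = 0 then 0 else
        (HahnSeries.C (y i) : LaurentSeries F).coeff
            (spExp a fun i => if i = 0 then f else RatFunc.C (y i)) -
          (expandAt a f).coeff (spExp a fun i => if i = 0 then f else RatFunc.C (y i)) := by
  by_cases h : i = 0 <;> simp [spTuple, h, expandAt_C]

/-- Constants have no coefficient in a nonzero degree, so all entries of the specialized tuple but
the first coincide. -/
theorem sym_spTuple_of_spExp_ne {n : ℕ} (hn : 2 ≤ n) (a : F) (f : RatFunc F)
    (y : Fin (n + 1) → F) (h : spExp a (fun i => if i = 0 then f else RatFunc.C (y i)) ≠ 0) :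
    sym (spTuple a fun i => if i = 0 then f else RatFunc.C (y i)) = 0 := by
  rw [← sym_zero_const hn (-(expandAt a f).coeff
    (spExp a fun i => if i = 0 then f else RatFunc.C (y i)))]
  congr 1; funext i
  rw [spTuple_cons, HahnSeries.C_apply, HahnSeries.coeff_single_of_ne h, zero_sub]

/-- Congruence modulo (t - a)^0 would force f minus a constant to be regular, so the exponent is not
0. -/
theorem sym_spTuple_of_hasPoleAt {n : ℕ} (hn : 2 ≤ n) {a : F} {f : RatFunc F}
    (y : Fin (n + 1) → F) (h : HasPoleAt a f) :
    sym (spTuple a fun i => if i = 0 then f else RatFunc.C (y i)) = 0 := by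
  refine sym_spTuple_of_spExp_ne hn a f y fun hs => ?_
  have hl : Fin.last n ≠ 0 := fun e => by have := congrArg Fin.val e; simp at this; omega
  have := (exists_spExp a (x := fun i => if i = 0 then f else RatFunc.C (y i))
    ⟨Fin.last n, by simpa [hl] using (h.ne_C _).symm⟩).1
  rw [hs] at this
  obtain ⟨r, hr, h⟩ := h
  have h0 := this 0 (Fin.last n) r hr
  simp only [hl, if_true, if_false, map_sub, HahnSeries.coeff_sub, (hasValueAt_C a _).1 r hr,
    sub_zero] at h0
  exact h h0

theorem sym_spTuple_of_hasValueAt {n : ℕ} (hn : 2 ≤ n) {a v : F} {f : RatFunc F}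
    (y : Fin (n + 1) → F) (h : HasValueAt a f v) :
    sym (spTuple a fun i => if i = 0 then f else RatFunc.C (y i)) =
      sym fun i => if i = 0 then v else y i := by
  have hval : ∀ i, HasValueAt a (if i = 0 then f else RatFunc.C (y i)) (if i = 0 then v else y i) :=
    fun i => by split_ifs; exacts [h, hasValueAt_C a _]
  by_cases hs : spExp a (fun i => if i = 0 then f else RatFunc.C (y i)) = 0
  · rw [← sym_translate _ v]
    congr 1; funext i
    rw [spTuple_cons, hs, h.2, HahnSeries.C_apply, HahnSeries.coeff_single_same]
    split_ifs <;> simp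
  -- All entries are regular, so a nonzero exponent means that their values at a all coincide; then
  -- both sides vanish.
  · rw [sym_spTuple_of_spExp_ne hn a f y hs]
    by_cases hall : ∀ i, (if i = 0 then v else y i) = v
    · simp only [hall, sym_const]
    · push Not at hall
      obtain ⟨i, hi⟩ := hall
      refine absurd (spExp_eq (i := i) (j := 0) (s := 0) (fun i j r hr => ?_) ?_) hs
      · rw [map_sub, HahnSeries.coeff_sub, (hval i).1 r hr, (hval j).1 r hr, sub_zero]
      · rw [map_sub, HahnSeries.coeff_sub, (hval i).2, (hval 0).2, if_pos rfl]
        exact sub_ne_zero.2 hi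

theorem wordSym_cons_map {K : Type*} [Field K] {n : ℕ} (f : F →+* K) (z : K) (X : List F) :
    wordSym n (z :: X.map f) =
      sym fun i : Fin (n + 1) => if i = 0 then z else f ((0 :: X).getD i 0) := by
  unfold wordSym wd
  congr 1; funext i
  refine Fin.cases ?_ (fun j => ?_) i
  · simp
  · simp only [Fin.val_succ, List.getD_cons_succ, Fin.succ_ne_zero, if_false]
    rw [← map_zero f, List.getD_map]

theorem Sp_word_of_hasPoleAt {n : ℕ} (hn : 2 ≤ n) {a : F} {f : RatFunc F} (X : List F)
    (h : HasPoleAt a f) : Sp n a (wordSym n (f :: X.map RatFunc.C)) = 0 := by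
  rw [wordSym_cons_map, Sp, liftA_sym, sym_spTuple_of_hasPoleAt hn _ h]

theorem Sp_word_of_hasValueAt {n : ℕ} (hn : 2 ≤ n) {a v : F} {f : RatFunc F} (X : List F)
    (h : HasValueAt a f v) :
    Sp n a (wordSym n (f :: X.map RatFunc.C)) = wordSym n (v :: X) := by
  rw [wordSym_cons_map, Sp, liftA_sym, sym_spTuple_of_hasValueAt hn _ h]
  simpa using (wordSym_cons_map (RingHom.id F) v X).symm

/-! ### The inversion formula -/

theorem Sp_invDefect {n : ℕ} (hn : 2 ≤ n) (a : F) (z : RatFunc F) (X : List F) :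
    Sp n a (invDefect n z (X.map RatFunc.C)) =
      Sp n a (wordSym n (z :: X.map RatFunc.C)) - wordSym n (0 :: X) -
        wordInv X fun X' => Sp n a (wordSym n (z⁻¹ :: X'.map RatFunc.C)) := by
  have h0 : HasValueAt a 0 0 := by simpa using hasValueAt_C a 0
  have := map_wordInv (Sp n a).toAddMonoidHom (X.map RatFunc.C)
    fun X' => wordSym n (z⁻¹ :: X')
  simp only [LinearMap.toAddMonoidHom_coe, wordInv_map] at this
  rw [invDefect, map_sub, map_sub, Sp_word_of_hasValueAt hn X h0, wordInv_map, this]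

theorem Sp_sub_Sp_invDefect_mem {n : ℕ} (hn : 2 ≤ n)
    (ih : ∀ m, 1 ≤ m → m < n → InvFormula m (RatFunc F) ∧ InvFormulaInfty m (RatFunc F))
    {z : RatFunc F} (hz : z ≠ 0) (hzC : ∀ c, z ≠ RatFunc.C c) {X : List F} (hX : X.length = n) :
    Sp n 0 (invDefect n z (X.map RatFunc.C)) - Sp n 1 (invDefect n z (X.map RatFunc.C)) ∈
      relSpace n F := by
  rw [relSpace, if_pos hn]
  refine Submodule.subset_span ⟨_, fun p q h hp hq => ?_, rfl⟩
  -- As z is nonconstant it is not a letter of the constant word, which excludes the weight 1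
  -- exception.
  refine cobracket_invDefect h (ih p hp (by omega)).1 (ih p hp (by omega)).2
    (ih q hq (by omega)).1 (ih q hq (by omega)).2 hz (fun h => ?_) (by simpa using hX)
  obtain ⟨c, -, hc⟩ := List.mem_map.1 h
  exact hzC c hc.symm

theorem mkQ_invDefect (n : ℕ) (z : F) (X : List F) :
    (relSpace n F).mkQ (invDefect n z X) =
      wordCor n (z :: X) - wordCor n (0 :: X) - wordInv X fun X' => wordCor n (z⁻¹ :: X') := by
  have := map_wordInv (relSpace n F).mkQ.toAddMonoidHom X fun X' => wordSym n (z⁻¹ :: X')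
  simp only [LinearMap.toAddMonoidHom_coe] at this
  rw [invDefect, map_sub, map_sub, this]
  rfl

/-- Take tz as distinguished letter. At t = 0 it becomes 0 and its inverse has a pole, so the defect
specializes to cor(0, X) - cor(0, X) - 0 = 0; at t = 1 it is the defect for z. -/
theorem invDefect_mem {n : ℕ} (hn : 2 ≤ n)
    (ih : ∀ m, 1 ≤ m → m < n → InvFormula m (RatFunc F) ∧ InvFormulaInfty m (RatFunc F))
    {z : F} (hz : z ≠ 0) {X : List F} (hX : X.length = n) : invDefect n z X ∈ relSpace n F := by
  have hp := hasPoleAt_inv_X_mul_C hz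
  have hne : (RatFunc.X * RatFunc.C z : RatFunc F) ≠ 0 := fun h => by
    simp [RatFunc.X_ne_zero, hz] at h
  have h0 := hasValueAt_X_mul_C 0 z
  have h1 := hasValueAt_X_mul_C 1 z
  rw [zero_mul] at h0
  rw [one_mul] at h1
  have := Sp_sub_Sp_invDefect_mem hn ih hne
    (fun c h => hp.ne_C c⁻¹ (by rw [h, map_inv₀])) hX
  rw [Sp_invDefect hn, Sp_invDefect hn, Sp_word_of_hasValueAt hn X h0,
    Sp_word_of_hasValueAt hn X h1] at this
  simp only [Sp_word_of_hasPoleAt hn _ hp, Sp_word_of_hasValueAt hn _ (h1.inv hz), wordInv_zero,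
    sub_self, zero_sub] at this
  exact (Submodule.neg_mem_iff _).1 this

theorem invFormula_of_lt {n : ℕ} (hn : 2 ≤ n)
    (ih : ∀ m, 1 ≤ m → m < n → InvFormula m (RatFunc F) ∧ InvFormulaInfty m (RatFunc F)) :
    InvFormula n F := by
  intro z X hz hX _
  have := (Submodule.Quotient.mk_eq_zero _).2 (invDefect_mem hn ih hz hX)
  exact (sub_eq_zero.1 ((mkQ_invDefect n z X).symm.trans this)).symm

theorem invFormulaInfty_of_lt {n : ℕ} (hn : 2 ≤ n)
    (ih : ∀ m, 1 ≤ m → m < n → InvFormula m (RatFunc F) ∧ InvFormulaInfty m (RatFunc F)) :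
    InvFormulaInfty n F := by
  intro X hX
  have hp := hasPoleAt_inv_X_mul_C (one_ne_zero (α := F))
  have h0 := hasValueAt_X_mul_C 0 (1 : F)
  have h1 := hasValueAt_X_mul_C 1 (1 : F)
  simp only [map_one, mul_one] at hp h0 h1
  have h1' := h1.inv one_ne_zero
  -- With distinguished letter 1/t, the leading word dies at t = 0 and the inverse letter becomes 0,
  -- which produces the formula sought. The value at t = 1 is the defect for z = 1, already known to
  -- be a relation.
  have := Sp_sub_Sp_invDefect_mem hn ih (inv_ne_zero RatFunc.X_ne_zero) hp.ne_C hX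
  rw [Sp_invDefect hn, Sp_invDefect hn, inv_inv, Sp_word_of_hasPoleAt hn X hp,
    Sp_word_of_hasValueAt hn X h1'] at this
  simp only [Sp_word_of_hasValueAt hn _ h0, Sp_word_of_hasValueAt hn _ h1] at this
  have h := invDefect_mem hn ih one_ne_zero hX
  rw [invDefect, inv_one] at h
  rw [inv_one] at this
  have key := (Submodule.Quotient.mk_eq_zero _).2 ((Submodule.add_mem _ this h))
  rw [sub_add_cancel] at key
  have hw := map_wordInv (relSpace n F).mkQ.toAddMonoidHom X fun X' => wordSym n (0 :: X')
  simp only [LinearMap.toAddMonoidHom_coe] at hw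
  change (relSpace n F).mkQ _ = 0 at key
  rw [map_sub, map_sub, map_zero, hw] at key
  change 0 - wordCor n (0 :: X) - wordInv X (fun X' => wordCor n (0 :: X')) = 0 at key
  rw [zero_sub] at key
  exact (sub_eq_zero.1 key).symm

/-! ### Weight one: logarithms. -/

/-- The class of `((0, x))`. -/
def logSym (x : F) : A 1 F := sym ![0, x]

theorem logSym_zero : logSym (0 : F) = 0 := by
  rw [logSym, ← sym_const (F := F) (n := 1) 0]; congr 1; funext i; fin_cases i <;> rfl

theorem logSym_mul {x y : F} (hx : x ≠ 0) (hy : y ≠ 0) :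
    logSym (x * y) = logSym x + logSym y :=
  sym_log (Units.mk0 x hx) (Units.mk0 y hy)

theorem logSym_one : logSym (1 : F) = 0 := by
  simpa using logSym_mul (one_ne_zero (α := F)) one_ne_zero

theorem logSym_neg (x : F) : logSym (-x) = logSym x := by
  by_cases hx : x = 0
  · rw [hx, neg_zero]
  have h : logSym (-1 : F) + logSym (-1 : F) = 0 := by
    rw [← logSym_mul (by simp) (by simp)]; simp [logSym_one]
  -- log(-1) is 2-torsion in a rational vector space.
  have h' : logSym (-1 : F) = 0 := by
    have h2 : (2 : ℚ) • logSym (-1 : F) = 0 := by rw [two_smul]; exact h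
    exact (smul_eq_zero.1 h2).resolve_left two_ne_zero
  rw [← neg_one_mul, logSym_mul (by simp) hx, h', zero_add]

theorem logSym_inv (x : F) : logSym x⁻¹ = - logSym x := by
  by_cases hx : x = 0
  · simp [hx, logSym_zero]
  · refine eq_neg_of_add_eq_zero_left ?_
    rw [← logSym_mul (inv_ne_zero hx) hx, inv_mul_cancel₀ hx, logSym_one]

theorem wordSym_pair (x y : F) : wordSym 1 [x, y] = logSym (y - x) := by
  rw [wordSym, wd_pair]; rfl

theorem wordCor_pair (x y : F) : wordCor 1 [x, y] = (relSpace 1 F).mkQ (logSym (y - x)) := by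
  rw [wordCor, wordSym_pair]

theorem invFormula_one : InvFormula 1 F := by
  intro z X hz hX hzX
  obtain ⟨x, rfl⟩ := List.length_eq_one_iff.1 hX
  have hzx : z ≠ x := by simpa using hzX rfl
  simp only [wordInv, letterInv, wordCor_pair]
  by_cases hx : x = 0
  · simp [hx, logSym_zero, logSym_neg, logSym_inv]
  · have e : x⁻¹ - z⁻¹ = (z - x) * (x⁻¹ * z⁻¹) := by field_simp
    rw [if_neg hx, e, logSym_mul (sub_ne_zero.2 hzx)
      (mul_ne_zero (inv_ne_zero hx) (inv_ne_zero hz)), logSym_mul (inv_ne_zero hx)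
      (inv_ne_zero hz), ← neg_sub x z, logSym_neg, zero_sub, logSym_neg, sub_zero, logSym_inv,
      logSym_inv, ← map_sub, ← map_sub]
    congr 1; abel

theorem invFormulaInfty_one : InvFormulaInfty 1 F := by
  intro X hX
  obtain ⟨x, rfl⟩ := List.length_eq_one_iff.1 hX
  simp only [wordInv, letterInv, wordCor_pair]
  by_cases hx : x = 0 <;> simp [hx, logSym_zero, logSym_inv]

end

theorem invFormula (n : ℕ) (hn : 1 ≤ n) (F : Type u) [Field F] :
    InvFormula n F ∧ InvFormulaInfty n F := by
  -- The field must vary: weight n over F uses lower weights over F(t).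
  induction n using Nat.strong_induction_on generalizing F with
  | _ n ih =>
    rcases hn.eq_or_lt with rfl | hn
    · exact ⟨invFormula_one, invFormulaInfty_one⟩
    · have ih' := fun m (h1 : 1 ≤ m) (h2 : m < n) => ih m h2 h1 (RatFunc F)
      exact ⟨invFormula_of_lt hn ih', invFormulaInfty_of_lt hn ih'⟩

section
variable {F : Type u} [Field F]

/-! ### The depth filtration in terms of nonzero letters -/

open Classical in
/-- The number of nonzero letters of a word. -/
def nzCount (l : List F) : ℕ := (l.map fun x => if x = 0 then 0 else 1).sum

@[simp] theorem nzCount_nil : nzCount ([] : List F) = 0 := rfl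

@[simp] theorem nzCount_zero_cons (l : List F) : nzCount (0 :: l) = nzCount l := by
  simp [nzCount]

theorem nzCount_cons {x : F} (hx : x ≠ 0) (l : List F) : nzCount (x :: l) = nzCount l + 1 := by
  simp [nzCount, hx, add_comm]

@[simp] theorem nzCount_append (l₁ l₂ : List F) :
    nzCount (l₁ ++ l₂) = nzCount l₁ + nzCount l₂ := by
  simp [nzCount]

@[simp] theorem nzCount_replicate (n : ℕ) : nzCount (List.replicate n (0 : F)) = 0 := by
  simp [nzCount]

theorem nzCount_map {f : F → F} (hf : ∀ x, f x = 0 ↔ x = 0) (l : List F) :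
    nzCount (l.map f) = nzCount l := by
  induction l with
  | nil => rfl
  | cons x l ih =>
    by_cases hx : x = 0
    · simp [hx, (hf 0).2 rfl, ih]
    · rw [List.map_cons, nzCount_cons hx, nzCount_cons (mt (hf x).1 hx), ih]

theorem nzCount_map_inv (l : List F) : nzCount (l.map (·⁻¹)) = nzCount l :=
  nzCount_map (fun _ => inv_eq_zero) l

theorem nzCount_flatten_ofFn {k : ℕ} (f : Fin k → List F) :
    nzCount (List.ofFn f).flatten = ∑ i, nzCount (f i) := by
  induction k with
  | zero => simp
  | succ k ih => simp [List.ofFn_succ, Fin.sum_univ_succ, ih]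

theorem exists_eq_replicate_append_cons {l : List F} (hl : nzCount l ≠ 0) :
    ∃ (m : ℕ) (z : F) (B : List F), z ≠ 0 ∧ l = List.replicate m 0 ++ z :: B := by
  induction l with
  | nil => simp at hl
  | cons x l ih =>
    by_cases hx : x = 0
    · subst hx
      obtain ⟨m, z, B, hz, rfl⟩ := ih (by simpa using hl)
      exact ⟨m + 1, z, B, hz, rfl⟩
    · exact ⟨0, x, l, hx, rfl⟩

theorem eq_replicate_of_nzCount_eq_zero {l : List F} (hl : nzCount l = 0) :
    l = List.replicate l.length 0 := by
  induction l with
  | nil => rfl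
  | cons x l ih =>
    by_cases hx : x = 0
    · subst hx
      rw [List.length_cons, List.replicate_succ, ← ih (by simpa using hl)]
    · rw [nzCount_cons hx] at hl; omega

section wordInv
variable {M : Type*} [AddCommGroup M] [Module ℚ M] {S : Submodule ℚ M}

theorem wordInv_mem {l : List F} {g : List F → M}
    (h : ∀ l', l'.length = l.length → nzCount l' ≤ nzCount l → g l' ∈ S) : wordInv l g ∈ S := by
  induction l generalizing g with
  | nil => exact h [] rfl le_rfl
  | cons x l ih =>
    rw [wordInv, letterInv]
    have h0 : wordInv l (fun l' => g (0 :: l')) ∈ S := ih fun l' hl hc => h _ (by simp [hl]) (by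
      by_cases hx : x = 0
      · simpa [hx] using hc
      · rw [nzCount_cons hx, nzCount_zero_cons]; omega)
    split_ifs with hx
    · exact S.sub_mem S.zero_mem h0
    · refine S.sub_mem (ih fun l' hl hc => h _ (by simp [hl]) ?_) h0
      rw [nzCount_cons (inv_ne_zero hx), nzCount_cons hx]; omega

/-- Choosing [x⁻¹] for every nonzero letter is the only choice that keeps their number. Each zero
letter contributes a factor -1, and the number of zeros has the parity of the length plus `nzCount
l`. -/
theorem wordInv_sub_leading_mem {l : List F} {g : List F → M}
    (h : ∀ l', l'.length = l.length → nzCount l' < nzCount l → g l' ∈ S) :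
    wordInv l g - (-1 : ℚ) ^ (l.length + nzCount l) • g (l.map (·⁻¹)) ∈ S := by
  induction l generalizing g with
  | nil => simp [wordInv]
  | cons x l ih =>
    rw [wordInv, letterInv]
    by_cases hx : x = 0
    · subst hx
      have := S.neg_mem (ih (g := fun l' => g (0 :: l'))
        fun l' hl hc => h _ (by simp [hl]) (by simpa using hc))
      rw [if_pos rfl, nzCount_zero_cons, List.length_cons, List.map_cons, inv_zero]
      convert this using 1
      rw [show l.length + 1 + nzCount l = l.length + nzCount l + 1 by omega, pow_succ]
      module
    · have h1 := ih (g := fun l' => g (x⁻¹ :: l'))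
        fun l' hl hc => h _ (by simp [hl]) (by
          rw [nzCount_cons (inv_ne_zero hx), nzCount_cons hx]; omega)
      have h2 : wordInv l (fun l' => g (0 :: l')) ∈ S :=
        wordInv_mem fun l' hl hc => h _ (by simp [hl]) (by
          rw [nzCount_cons hx, nzCount_zero_cons]; omega)
      rw [if_neg hx, nzCount_cons hx, List.length_cons, List.map_cons]
      convert S.sub_mem h1 h2 using 1
      rw [show l.length + 1 + (nzCount l + 1) = l.length + nzCount l + 2 by omega, pow_add]
      module

end wordInv

theorem prod_Iic_zero {k : ℕ} (f : Fin (k + 1) → F) : ∏ j ∈ Finset.Iic 0, f j = f 0 := by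
  have : Finset.Iic (0 : Fin (k + 1)) = {0} := by ext; simp
  rw [this, Finset.prod_singleton]

theorem prod_Iic_succ {k : ℕ} (f : Fin (k + 1) → F) (i : Fin k) :
    ∏ j ∈ Finset.Iic i.succ, f j = f 0 * ∏ j ∈ Finset.Iic i, f j.succ := by
  have : Finset.Iic i.succ = insert 0 ((Finset.Iic i).map (Fin.succEmb k)) := by
    ext j
    refine Fin.cases ?_ (fun j => ?_) j <;> simp
  rw [this, Finset.prod_insert (by simp), Finset.prod_map]
  rfl

/-- The arguments are the ratios of consecutive nonzero letters. Here c is the nonzero letter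
preceding the word; letting it vary allows the induction to restart after each nonzero letter. -/
theorem exists_blocks (l : List F) {b c : F} (hb : b ≠ 0) (hc : c ≠ 0) :
    ∃ (w : Fin (nzCount l + 1) → ℕ+) (a : Fin (nzCount l + 1) → Fˣ),
      l ++ [b] = (List.ofFn fun i =>
        List.replicate ((w i : ℕ) - 1) 0 ++ [c * ∏ j ∈ Finset.Iic i, (a j : F)]).flatten := by
  induction l generalizing c with
  | nil =>
    refine ⟨fun _ => 1, fun _ => Units.mk0 (c⁻¹ * b) (mul_ne_zero (inv_ne_zero hc) hb), ?_⟩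
    rw [nzCount_nil, List.ofFn_succ, prod_Iic_zero]
    simp [hc]
  | cons x l ih =>
    by_cases hx : x = 0
    · subst hx
      obtain ⟨w, a, h⟩ := ih hc
      rw [nzCount_zero_cons]
      refine ⟨Function.update w 0 (w 0 + 1), a, ?_⟩
      rw [List.cons_append, h, List.ofFn_succ, List.ofFn_succ]
      have : (w 0 : ℕ) = ((w 0 : ℕ) - 1) + 1 := (Nat.sub_add_cancel (w 0).pos).symm
      simp only [Function.update_self, PNat.add_coe, PNat.one_coe, Nat.add_sub_cancel,
        Function.update_of_ne (Fin.succ_ne_zero _), List.flatten_cons]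
      nth_rewrite 2 [this]
      rw [List.replicate_succ]
      rfl
    · obtain ⟨w, a, h⟩ := ih hx
      rw [nzCount_cons hx]
      refine ⟨Fin.cons 1 w,
        Fin.cons (Units.mk0 (c⁻¹ * x) (mul_ne_zero (inv_ne_zero hc) hx)) a, ?_⟩
      rw [List.cons_append, h, List.ofFn_succ (n := nzCount l + 1)]
      simp only [prod_Iic_zero, prod_Iic_succ, Fin.cons_zero, Fin.cons_succ, Units.val_mk0,
        mul_inv_cancel_left₀ hc, ← mul_assoc]
      rfl

theorem Li_eq {k n n₀ : ℕ} {w : Fin k → ℕ+} {a : Fin k → Fˣ} (h : n₀ + ∑ i, (w i : ℕ) = n)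
    {Y : List F} {z : F} (hY : liWord n₀ w a = 0 :: (Y ++ [z])) :
    Li n₀ w a h = (-1 : ℚ) ^ k • (wordCor n (Y ++ [z]) - wordCor n (0 :: Y)) := by
  have hl := liWord_length n₀ w a h
  have hYl : Y.length = n := by rw [hY] at hl; simpa using hl
  have hget : ∀ i (hi : i < n + 2),
      (liWord n₀ w a)[i]'(by rw [hl]; exact hi) = (0 :: (Y ++ [z])).getD i 0 := fun i hi => by
    rw [List.getD_eq_getElem _ _ (by simp [hYl]; omega)]
    simp only [hY]
  unfold Li iterInt
  congr 2
  · unfold wordCor wordSym wd cor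
    congr 2; funext i
    exact hget _ i.succ.isLt
  · unfold wordCor wordSym wd cor
    congr 2; funext i
    refine (hget _ i.castSucc.isLt).trans ?_
    rw [← List.cons_append, List.getD_append _ _ _ _ (by simp [hYl]; omega)]
    rfl

theorem wordCor_scale {n : ℕ} (hn : 2 ≤ n) {m : F} (hm : m ≠ 0) (l : List F) :
    wordCor n (l.map (m * ·)) = wordCor n l := by
  unfold wordCor wordSym
  rw [← wd_scale hn (fun i => l.getD i 0) (Units.mk0 m hm)]
  congr 2; funext i
  have := List.getD_map (n := i) (l := l) (d := (0 : F)) (m * ·)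
  simpa using this

theorem wordCor_eq_zero {n : ℕ} (hn : 2 ≤ n) {l : List F} (hl : l.length = n + 1)
    (hc : nzCount l ≤ 1) : wordCor n l = 0 := by
  rcases Nat.le_one_iff_eq_zero_or_eq_one.1 hc with hc | hc
  · rw [eq_replicate_of_nzCount_eq_zero hc, wordCor, wordSym,
      wd_zero 0 (fun a _ => by simp), map_zero]
  · obtain ⟨m, z, B, hz, rfl⟩ := exists_eq_replicate_append_cons (hc ▸ one_ne_zero)
    have hB : nzCount (B ++ List.replicate m (0 : F)) = 0 := by
      simp [nzCount_cons hz] at hc ⊢; exact hc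
    rw [wordCor_append_comm hl, List.cons_append, eq_replicate_of_nzCount_eq_zero hB,
      ← wordCor_scale hn (inv_ne_zero hz), wordCor, wordSym, wd_one, map_zero]
    · simp [hz]
    · intro a h1 _
      obtain ⟨a, rfl⟩ := Nat.exists_eq_add_of_le' h1
      simp

theorem liWord_of_blocks {n₀ k : ℕ} {w : Fin k → ℕ+} {a : Fin k → Fˣ} {V : List F} (hV : V =
      (List.ofFn fun i : Fin k =>
        List.replicate ((w i : ℕ) - 1) 0 ++ [1 * ∏ j ∈ Finset.Iic i, (a j : F)]).flatten) :
    liWord n₀ w a = 0 :: (List.replicate n₀ 0 ++ 1 :: V) := by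
  simp only [one_mul] at hV
  simp [liWord, ← hV]

/-- A correlator with at most `m + 1` nonzero letters has depth at most `m`. -/
theorem wordCor_mem_depthFiltration {n : ℕ} (hn : 2 ≤ n) {m : ℕ} {l : List F}
    (hl : l.length = n + 1) (hc : nzCount l ≤ m + 1) : wordCor n l ∈ depthFiltration m n F := by
  induction hr : nzCount l generalizing l with
  | zero => rw [wordCor_eq_zero hn hl (by omega)]; exact Submodule.zero_mem _
  | succ r ih =>
    rcases Nat.eq_zero_or_pos r with rfl | hr0
    · rw [wordCor_eq_zero hn hl (by omega)]; exact Submodule.zero_mem _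
    obtain ⟨i, z, B, hz, rfl⟩ := exists_eq_replicate_append_cons (l := l) (by omega)
    have hcB : nzCount B = r := by simpa [nzCount_cons hz] using hr
    obtain ⟨n₀, y, V, hy, rfl⟩ := exists_eq_replicate_append_cons (l := B) (by omega)
    -- Rotating puts the first nonzero letter z last, and scaling by y⁻¹ turns the next one into 1,
    -- as in the word of a polylogarithm.
    have e1 : List.replicate i 0 ++ z :: (List.replicate n₀ 0 ++ y :: V) =
        (List.replicate i 0 ++ [z]) ++ (List.replicate n₀ 0 ++ y :: V) := by simp
    rw [e1, wordCor_append_comm (by simpa using hl), ← wordCor_scale hn (inv_ne_zero hy)]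
    have hmul : ∀ x, y⁻¹ * x = 0 ↔ x = 0 := fun x => by simp [hy]
    have hcV : nzCount V + 1 = r := by simpa [nzCount_cons hy] using hcB
    set V' := V.map (y⁻¹ * ·) ++ List.replicate i 0 with hV'
    have hcV' : nzCount V' + 1 = r := by simp [hV', nzCount_map hmul, hcV]
    have e2 : ((List.replicate n₀ 0 ++ y :: V) ++ (List.replicate i 0 ++ [z])).map (y⁻¹ * ·) =
        (List.replicate n₀ 0 ++ 1 :: V') ++ [y⁻¹ * z] := by
      simp [hV', hy]
    rw [e2]
    obtain ⟨w, a, hwa⟩ := exists_blocks V' (mul_ne_zero (inv_ne_zero hy) hz)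
      (one_ne_zero (α := F))
    have hli : liWord n₀ w a = 0 :: ((List.replicate n₀ 0 ++ 1 :: V') ++ [y⁻¹ * z]) := by
      rw [liWord_of_blocks hwa]; simp
    have hlen : ((List.replicate n₀ 0 ++ 1 :: V') ++ [y⁻¹ * z]).length = n + 1 := by
      rw [← e2]; simp at hl ⊢; omega
    have h : n₀ + ∑ i, (w i : ℕ) = n := by
      have h1 := liWord_length n₀ w a rfl
      rw [hli, List.length_cons, hlen] at h1
      omega
    have hLi : Li n₀ w a h ∈ depthFiltration m n F :=
      Submodule.subset_span ⟨_, n₀, w, a, h, by omega, by omega, rfl⟩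
    -- Up to sign, the polylogarithm is the given correlator minus this one, in which 0 replaces the
    -- last nonzero letter; induction on the number of nonzero letters applies.
    have hlow : wordCor n (0 :: (List.replicate n₀ 0 ++ 1 :: V')) ∈ depthFiltration m n F := by
      refine ih (by simp at hlen ⊢; omega) ?_ ?_ <;>
        simp [nzCount_cons (one_ne_zero (α := F))] <;> omega
    have key := Submodule.smul_mem _ ((-1 : ℚ) ^ (nzCount V' + 1)) hLi
    rw [Li_eq h hli, smul_smul, ← mul_pow, neg_one_mul, neg_neg, one_pow, one_smul] at key
    simpa using Submodule.add_mem _ key hlow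

/-! ### Inversion of multiple polylogarithms modulo lower depth. -/

theorem exists_liWord_eq {k : ℕ} (hk : 1 ≤ k) (n₀ : ℕ) (w : Fin k → ℕ+) (a : Fin k → Fˣ) :
    ∃ (Y : List F) (z : F), z ≠ 0 ∧ liWord n₀ w a = 0 :: (Y ++ [z]) ∧ nzCount Y = k := by
  obtain ⟨k, rfl⟩ := Nat.exists_eq_add_of_le' hk
  have hz : ∀ i : Fin (k + 1), ∏ j ∈ Finset.Iic i, (a j : F) ≠ 0 :=
    fun i => Finset.prod_ne_zero_iff.2 fun j _ => (a j).ne_zero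
  refine ⟨List.replicate n₀ 0 ++ 1 :: ((List.ofFn fun i : Fin k =>
    List.replicate ((w i.castSucc : ℕ) - 1) 0 ++ [∏ j ∈ Finset.Iic i.castSucc, (a j : F)]).flatten
      ++ List.replicate ((w (Fin.last k) : ℕ) - 1) 0), _, hz (Fin.last k), ?_, ?_⟩
  · unfold liWord
    rw [List.ofFn_succ_last]
    simp
  · simp [nzCount_cons (one_ne_zero (α := F)), nzCount_flatten_ofFn, nzCount_cons (hz _)]

theorem liWord_inv {k : ℕ} (n₀ : ℕ) (w : Fin k → ℕ+) (a : Fin k → Fˣ) :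
    liWord n₀ w (fun i => (a i)⁻¹) = (liWord n₀ w a).map (·⁻¹) := by
  simp [liWord, List.map_flatten, List.map_ofFn, Function.comp_def]

theorem Li_sub_Li_inv_mem {k n : ℕ} (hk : 1 ≤ k) (hn : 2 ≤ n) (n₀ : ℕ) (w : Fin k → ℕ+)
    (h : n₀ + ∑ i, (w i : ℕ) = n) (x : Fin k → Fˣ) :
    Li n₀ w x h - (-1 : ℚ) ^ (n + k) • Li n₀ w (fun i => (x i)⁻¹) h
      ∈ depthFiltration (k - 1) n F := by
  obtain ⟨Y, z, hz, hY, hcY⟩ := exists_liWord_eq hk n₀ w x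
  have hY' : liWord n₀ w (fun i => (x i)⁻¹) = 0 :: (Y.map (·⁻¹) ++ [z⁻¹]) := by
    rw [liWord_inv, hY]; simp
  have hl : Y.length = n := by
    have := liWord_length n₀ w x h
    rw [hY] at this; simpa using this
  -- A nonleading term has at most k - 1 nonzero letters besides z⁻¹, so at most k in all, which is
  -- the bound for depth k - 1.
  have hlead := wordInv_sub_leading_mem (S := depthFiltration (k - 1) n F) (l := Y)
    (g := fun X => wordCor n (z⁻¹ :: X)) fun l' hl' hc =>
      wordCor_mem_depthFiltration hn (by simp [hl', hl])
        (by rw [nzCount_cons (inv_ne_zero hz)]; omega)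
  -- The inverted polylogarithm also contains this correlator, which the leading term lacks; with k
  -- nonzero letters it is of lower depth.
  have hlow : wordCor n (0 :: Y.map (·⁻¹)) ∈ depthFiltration (k - 1) n F :=
    wordCor_mem_depthFiltration hn (by simp [hl])
      (by rw [nzCount_zero_cons, nzCount_map_inv]; omega)
  have hinv := (invFormula n (by omega) F).1 z Y hz hl (fun e => absurd e (by omega))
  rw [hinv, hl, hcY] at hlead
  rw [Li_eq h hY, Li_eq h hY', wordCor_append_comm (by simp [hl]),
    wordCor_append_comm (l₁ := Y.map (·⁻¹)) (by simp [hl])]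
  have := Submodule.smul_mem _ ((-1 : ℚ) ^ k)
    (Submodule.add_mem _ hlead (Submodule.smul_mem _ ((-1 : ℚ) ^ (n + k)) hlow))
  convert this using 1
  simp only [List.singleton_append]
  module

end

end FormalPolylog

end

open FormalPolylog in
theorem mainTheorem11 {F : Type*} [Field F] [Infinite F] {k n : ℕ} (hk : 1 ≤ k) (hn : 2 ≤ n)
    (n₀ : ℕ) (w : Fin k → ℕ+) (h : n₀ + ∑ i, (w i : ℕ) = n) (x : Fin k → Fˣ) :
    Li n₀ w x h - (-1 : ℚ) ^ (n + k) • Li n₀ w (fun i => (x i)⁻¹) h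
      ∈ depthFiltration (k - 1) n F :=
  Li_sub_Li_inv_mem hk hn n₀ w h x
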